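/- Work over $\mathbb C$. Let $R'=S_{3,4}\subseteq \mathbf P^8=\mathbf P(\mathbb C^4\oplus\mathbb C^5)$ be the smooth septic scroll, i.e. the union of the lines (rulings) $r_t=\langle (\nu_3(t),0),(0,\nu_4(t))\rangle$, $t\in\mathbf P^1$, where $\nu_d(s,u)=(s^d,s^{d-1}u,\dots,u^d)$, and let $\mathrm{Sec}(R')\subseteq\mathbf P^8$ be its secant variety, the Zariski closure of the union of the lines joining two distinct points of $R'$. Let $\mathbf G(1,5)\subseteq\mathbf P^{14}$ be the Grassmannian of lines in $\mathbf P^5$ in its Plücker embedding. Regard $\mathrm{Hom}_7(\mathbf P^1,\mathbf G(1,5))$, the set of morphisms of Plücker degree $7$, as a subvariety of the projective space of $15$-tuples of binary forms of degree $7$. Let $\mathcal U\subseteq \mathrm{Hom}_7(\mathbf P^1,\mathbf G(1,5))$ be the set of those $f$ such that (a) $f$ is an embedding (so $\Gamma:=f(\mathbf P^1)$ is a smooth rational septic curve); (b) there are three distinct lines in $\mathbf P^{14}$, each contained in $\mathbf G(1,5)$ and each joining two distinct points of $\Gamma$; (c) $f$ is the map of rulings of a projection of $S_{3,4}$ from a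 plane $3$-secant to $\mathrm{Sec}(R')$: there are a plane $\Lambda=\langle a_1,a_2,a_3\rangle\subseteq\mathbf P^8$ with $a_1,a_2,a_3\in\mathrm{Sec}(R')$ and $\Lambda\cap R'=\emptyset$, and a linear projection $\pi:\mathbf P^8\dashrightarrow\mathbf P^5$ with center $\Lambda$, such that $f(t)=[\pi(r_t)]$ for all $t\in\mathbf P^1$. For a $3$-plane $\mathbf P^3_p\subseteq\mathbf P^5$ let $\sigma_p=\{\ell\in\mathbf G(1,5):\ell\cap\mathbf P^3_p\neq\emptyset\}$ be its Schubert cycle, and let $W^1(\Gamma)=\{p\in\mathbf G(3,5):\Gamma\subseteq\sigma_p\}$. Theorem. For a general element $f$ of $\mathcal U$, i.e. for all $f$ in a nonempty, relatively Zariski open and Zariski dense subset of $\mathcal U$, the curve $\Gamma=f(\mathbf P^1)$ satisfies: the set $W^1(\Gamma)$ is finite, the linear span $\langle\Gamma\rangle\subseteq\mathbf P^{14}$ has dimension $7$, and $\Gamma$ is a rational normal septic curve in $\langle\Gamma\rangle$, i.e. it is the image of the standard rational normal curve $\nu_7(\mathbf P^1)\subseteq\mathbf P^7$ under a linear isomorphism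 $\mathbf P^7\cong\langle\Gamma\rangle$. -/

import Mathlib

open scoped LinearAlgebra.Projectivization

noncomputable section

namespace SepticScroll

/-! ### Zariski closed sets in projective space, and general points -/

/-- Zariski closed subsets of the projective space with homogeneous coordinates indexed by `ι`:
common zero loci of homogeneous polynomials. -/
def IsZariskiClosed {ι : Type} (Z : Set (ℙ ℂ (ι → ℂ))) : Prop :=
  ∃ S : Set (MvPolynomial ι ℂ), (∀ F ∈ S, ∃ d : ℕ, F.IsHomogeneous d) ∧
    Z = {x | ∀ F ∈ S, MvPolynomial.eval x.rep F = 0}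

/-- The Zariski closure of a set of points of projective space. -/
def zariskiClosure {ι : Type} (X : Set (ℙ ℂ (ι → ℂ))) : Set (ℙ ℂ (ι → ℂ)) :=
  {x | ∀ Z : Set (ℙ ℂ (ι → ℂ)), IsZariskiClosed Z → X ⊆ Z → x ∈ Z}

/-- The property `Q` holds for a general element of `X`: it holds on a nonempty, relatively
Zariski open, and Zariski dense subset of `X`. -/
def ForGeneral {ι : Type} (X : Set (ℙ ℂ (ι → ℂ))) (Q : ℙ ℂ (ι → ℂ) → Prop) : Prop :=
  ∃ Z : Set (ℙ ℂ (ι → ℂ)), IsZariskiClosed Z ∧ (X \ Z).Nonempty ∧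
    X ⊆ zariskiClosure (X \ Z) ∧ ∀ x ∈ X \ Z, Q x

/-! ### The Grassmannian of lines in `ℙ⁵` and its Plücker embedding in `ℙ¹⁴` -/

/-- The 15 Plücker indices `i < j`. -/
abbrev PIdx : Type := {p : Fin 6 × Fin 6 // p.1 < p.2}

/-- The projective line. -/
abbrev P1 : Type := ℙ ℂ (Fin 2 → ℂ)

/-- The Plücker space. -/
abbrev P14 : Type := ℙ ℂ (PIdx → ℂ)

/-- The vector of `2 × 2` minors `aᵢ bⱼ - aⱼ bᵢ`; it is nonzero exactly when `a` and `b` are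
linearly independent. -/
def pluckerVec (a b : Fin 6 → ℂ) : PIdx → ℂ :=
  fun p => a p.1.1 * b p.1.2 - a p.1.2 * b p.1.1

/-- `x` is the Plücker point of the line of `ℙ⁵` given by the 2-dimensional subspace `L`. -/
def IsPluckerPoint (L : Submodule ℂ (Fin 6 → ℂ)) (x : P14) : Prop :=
  ∃ (a b : Fin 6 → ℂ) (h : pluckerVec a b ≠ 0),
    L = Submodule.span ℂ {a, b} ∧ x = Projectivization.mk ℂ (pluckerVec a b) h

/-- The Grassmannian `G(1,5)` in its Plücker embedding. -/
def G15 : Set P14 := {x | ∃ L, IsPluckerPoint L x}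

/-- The Schubert cycle of the lines of `ℙ⁵` that meet the linear subspace `ℙ(p)`. -/
def schubertCycle (p : Submodule ℂ (Fin 6 → ℂ)) : Set P14 :=
  {x | ∃ L, IsPluckerPoint L x ∧ L ⊓ p ≠ ⊥}

/-- `W¹(Γ)`: the 3-planes of `ℙ⁵` (4-dimensional subspaces of `ℂ⁶`) whose Schubert cycle
contains `Γ`. -/
def W1 (Γ : Set P14) : Set (Submodule ℂ (Fin 6 → ℂ)) :=
  {p | Module.finrank ℂ p = 4 ∧ Γ ⊆ schubertCycle p}

/-- The linear subspace of homogeneous coordinate vectors underlying the projective span. -/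
def linSpan (Γ : Set P14) : Submodule ℂ (PIdx → ℂ) := ⨆ x ∈ Γ, x.submodule

/-! ### Degree 7 morphisms from `ℙ¹` to `G(1,5)` -/

/-- Coefficient vectors of 15-tuples of binary forms of degree 7. -/
abbrev Coeffs : Type := PIdx × Fin 8 → ℂ

/-- The binary form of degree 7 in the Plücker coordinate `p`. -/
def form (c : Coeffs) (p : PIdx) : MvPolynomial (Fin 2) ℂ :=
  ∑ k : Fin 8, MvPolynomial.C (c (p, k)) *
    (MvPolynomial.X 0 ^ (7 - (k : ℕ)) * MvPolynomial.X 1 ^ (k : ℕ))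

/-- The value at `v` of the 15-tuple of forms. -/
def evalVec (c : Coeffs) (v : Fin 2 → ℂ) : PIdx → ℂ :=
  fun p => MvPolynomial.eval v (form c p)

/-- The value at `v` of the partial derivative in the `j`-th variable of the 15-tuple. -/
def partialVec (c : Coeffs) (j : Fin 2) (v : Fin 2 → ℂ) : PIdx → ℂ :=
  fun p => MvPolynomial.eval v (MvPolynomial.pderiv j (form c p))

/-- The variety of morphisms `ℙ¹ → G(1,5)` of degree 7 (with respect to the Plücker embedding),
as a subset of the projective space of 15-tuples of binary septic forms up to scalars: the forms
have no common zero, and all values lie on the Grassmannian. -/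
def Hom7 : Set (ℙ ℂ Coeffs) :=
  {f | ∀ v : Fin 2 → ℂ, v ≠ 0 →
    ∃ h : evalVec f.rep v ≠ 0, Projectivization.mk ℂ (evalVec f.rep v) h ∈ G15}

/-- The graph of the morphism given by `f`: `y` is the value of `f` at the point `x`. -/
def IsValue (f : ℙ ℂ Coeffs) (x : P1) (y : P14) : Prop :=
  ∃ h : evalVec f.rep x.rep ≠ 0, y = Projectivization.mk ℂ (evalVec f.rep x.rep) h

/-- The image `Γ` of the morphism given by `f`. -/
def imageCurve (f : ℙ ℂ Coeffs) : Set P14 := {y | ∃ x : P1, IsValue f x y}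

/-- `f` is an embedding, i.e. it parametrizes a smooth rational septic curve: it separates
points, and it is unramified. (By the Euler relation the differential of the map of projective
spaces is injective if and only if the two partial derivatives of the tuple of forms are linearly
independent vectors.) -/
def IsEmbedding7 (f : ℙ ℂ Coeffs) : Prop :=
  (∀ (x x' : P1) (y : P14), IsValue f x y → IsValue f x' y → x = x') ∧
    ∀ v : Fin 2 → ℂ, v ≠ 0 →
      LinearIndependent ℂ ![partialVec f.rep 0 v, partialVec f.rep 1 v]

/-- The line `ℙ(N)` of the Plücker space is contained in `G(1,5)`, and it joins two distinct
points of `Γ`. -/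
def IsBisecantInG15 (Γ : Set P14) (N : Submodule ℂ (PIdx → ℂ)) : Prop :=
  (∃ y ∈ Γ, ∃ y' ∈ Γ, y ≠ y' ∧ N = y.submodule ⊔ y'.submodule) ∧
    ∀ z : P14, z.submodule ≤ N → z ∈ G15

/-! ### The scroll `S₃,₄` in `ℙ⁸`, its secant variety and its projections -/

/-- The Veronese vector `(s^d, s^(d-1) t, …, t^d)` of `v = (s, t)`. -/
def veronese (d : ℕ) (v : Fin 2 → ℂ) : Fin (d + 1) → ℂ :=
  fun i => v 0 ^ (d - (i : ℕ)) * v 1 ^ (i : ℕ)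

/-- `ℂ⁹ = ℂ⁴ ⊕ ℂ⁵`, so that `ℙ⁸` is the join of a 3-space and a 4-space. -/
abbrev C9 : Type := Fin 4 ⊕ Fin 5 → ℂ

/-- The point of the twisted cubic directrix. -/
def cubicPt (v : Fin 2 → ℂ) : C9 := Sum.elim (veronese 3 v) 0

/-- The point of the rational normal quartic. -/
def quarticPt (v : Fin 2 → ℂ) : C9 := Sum.elim 0 (veronese 4 v)

/-- The ruling of the scroll over `v`: the line joining corresponding points of the two curves. -/
def ruling (v : Fin 2 → ℂ) : Submodule ℂ C9 := Submodule.span ℂ {cubicPt v, quarticPt v}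

/-- The smooth septic scroll `S₃,₄ ⊆ ℙ⁸`. -/
def S34 : Set (ℙ ℂ C9) := {x | ∃ v : Fin 2 → ℂ, v ≠ 0 ∧ x.submodule ≤ ruling v}

/-- The secant variety of the scroll: the closure of the union of the lines joining two distinct
points of it. -/
def secS34 : Set (ℙ ℂ C9) :=
  zariskiClosure {z | ∃ x ∈ S34, ∃ y ∈ S34, x ≠ y ∧ z.submodule ≤ x.submodule ⊔ y.submodule}

/-- `f` is the map `v ↦ [π(ruling over v)]` of rulings of the image of the scroll under a linear
projection `π : ℙ⁸ ⇢ ℙ⁵`, with matrix `M`, whose center is a plane spanned by three points of the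
secant variety and disjoint from the scroll. -/
def IsRulingMapOfProjection (f : ℙ ℂ Coeffs) : Prop :=
  ∃ (a : Fin 3 → ℙ ℂ C9) (M : C9 →ₗ[ℂ] (Fin 6 → ℂ)),
    (∀ i, a i ∈ secS34) ∧
    Module.finrank ℂ (⨆ i, (a i).submodule : Submodule ℂ C9) = 3 ∧
    Function.Surjective M ∧
    LinearMap.ker M = ⨆ i, (a i).submodule ∧
    (∀ x ∈ S34, ¬ x.submodule ≤ LinearMap.ker M) ∧
    ∀ (x : P1) (y : P14), IsValue f x y → IsPluckerPoint ((ruling x.rep).map M) y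

/-- The family `𝒰 ⊆ Hom(ℙ¹, G(1,5))` of smooth rational septic curves that carry three bisecant
lines contained in `G(1,5)` and are curves of rulings of projections of `S₃,₄` from planes
3-secant to its secant variety. -/
def familyU : Set (ℙ ℂ Coeffs) :=
  {f | f ∈ Hom7 ∧ IsEmbedding7 f ∧
    (∃ N : Fin 3 → Submodule ℂ (PIdx → ℂ),
      Function.Injective N ∧ ∀ i, IsBisecantInG15 (imageCurve f) (N i)) ∧
    IsRulingMapOfProjection f}

/-- A rational normal curve of degree `d` in its linear span: the image of the standard one in
`ℙᵈ` under an injective linear map. -/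
def IsRationalNormalCurve (d : ℕ) (Γ : Set P14) : Prop :=
  ∃ T : (Fin (d + 1) → ℂ) →ₗ[ℂ] (PIdx → ℂ), Function.Injective T ∧
    Γ = {y | ∃ v : Fin 2 → ℂ, v ≠ 0 ∧
      ∃ h : T (veronese d v) ≠ 0, y = Projectivization.mk ℂ (T (veronese d v)) h}

end SepticScroll

end

open scoped LinearAlgebra.Projectivization

noncomputable section

namespace SepticScroll

/-! ### Polynomial functions -/

/-! Two conditions on a 15-tuple c of binary septics suffice. If its eight coefficient vectors are
independent (`coeffMap c` is injective), the curve is a linearly isomorphic image of the rational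
normal septic, which gives both the dimension of the span and the normality. For `W1`: a
4-dimensional p in ℂ⁶ is the radical of a decomposable alternating form w, and Γ ⊆ σ_p forces w to
annihilate every coefficient vector. Thus W¹(Γ) is controlled by a linear section of a Grassmannian,
and a projective variety missing some hyperplane is finite (`finite_zeros_off_hyperplane`,
`finite_W1`). This is the condition `HasAvoidingHyperplane`. By elimination
(`exists_polynomials_iff_only_zero`) both conditions together say that some form from a set S is
nonzero at c (`exists_polynomials_iff_generic`), so they are open.

Density rests on irreducibility. Each member of the family is a multiple of `projCoeffs M`, where
the kernel of M is spanned by three vectors in the cone over the secant variety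
(`exists_center_of_mem_familyU`). Triples of secant points are parametrized by an affine space, on
which a product of nonzero polynomials is nonzero. Let F be a form that is nonzero at a member.
`projAlong` moves the center while keeping F a function homogeneous separately in the three spanning
points, so its nonvanishing passes from the closure to actual parameters of secant points. Some form
of S is nonzero at the explicit plane `specialCenter`, where both conditions are computed by hand.
Multiplying these two functions by the polynomials that express general position gives a parameter
point where none of them vanishes.

That point gives a member of the family (`mk_projCoeffs_mem_familyU`): if the center meets the join
of two rulings in a suitable point, the images of these rulings intersect, so the line through their
Plücker points lies in G(1,5). Hence F is nonzero at a generic member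
(`exists_mem_familyU_eval_ne_zero`), which is density. The case F = 1 is nonemptiness. -/

/-- `g` is a polynomial function. -/
def IsPolyFun {τ : Type*} (g : (τ → ℂ) → ℂ) : Prop :=
  ∃ P : MvPolynomial τ ℂ, ∀ x, g x = MvPolynomial.eval x P

/-- `g` is given by a homogeneous polynomial of degree `d`. -/
def IsHomFun {τ : Type*} (d : ℕ) (g : (τ → ℂ) → ℂ) : Prop :=
  ∃ P : MvPolynomial τ ℂ, P.IsHomogeneous d ∧ ∀ x, g x = MvPolynomial.eval x P

section PolynomialFunctions

variable {τ υ : Type*}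

namespace IsPolyFun

theorem const (r : ℂ) : IsPolyFun (fun _ : τ → ℂ => r) :=
  ⟨MvPolynomial.C r, fun x => by simp⟩

theorem coord (i : τ) : IsPolyFun (fun x : τ → ℂ => x i) :=
  ⟨MvPolynomial.X i, fun x => by simp⟩

theorem eval (P : MvPolynomial τ ℂ) : IsPolyFun (fun x => MvPolynomial.eval x P) :=
  ⟨P, fun _ => rfl⟩

theorem add {g h : (τ → ℂ) → ℂ} (hg : IsPolyFun g) (hh : IsPolyFun h) :
    IsPolyFun (fun x => g x + h x) := by
  obtain ⟨P, hP⟩ := hg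
  obtain ⟨Q, hQ⟩ := hh
  exact ⟨P + Q, fun x => by simp [hP, hQ]⟩

theorem mul {g h : (τ → ℂ) → ℂ} (hg : IsPolyFun g) (hh : IsPolyFun h) :
    IsPolyFun (fun x => g x * h x) := by
  obtain ⟨P, hP⟩ := hg
  obtain ⟨Q, hQ⟩ := hh
  exact ⟨P * Q, fun x => by simp [hP, hQ]⟩

theorem sub {g h : (τ → ℂ) → ℂ} (hg : IsPolyFun g) (hh : IsPolyFun h) :
    IsPolyFun (fun x => g x - h x) := by
  obtain ⟨P, hP⟩ := hg
  obtain ⟨Q, hQ⟩ := hh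
  exact ⟨P - Q, fun x => by simp [hP, hQ]⟩

theorem pow {g : (τ → ℂ) → ℂ} (hg : IsPolyFun g) (n : ℕ) : IsPolyFun (fun x => g x ^ n) := by
  obtain ⟨P, hP⟩ := hg
  exact ⟨P ^ n, fun x => by simp [hP]⟩

theorem sum {ι : Type*} (s : Finset ι) {g : ι → (τ → ℂ) → ℂ} (hg : ∀ i, IsPolyFun (g i)) :
    IsPolyFun (fun x => ∑ i ∈ s, g i x) := by
  choose P hP using hg
  exact ⟨∑ i ∈ s, P i, fun x => by simp [hP]⟩

theorem comp {F : (υ → ℂ) → ℂ} (hF : IsPolyFun F) {g : υ → (τ → ℂ) → ℂ}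
    (hg : ∀ i, IsPolyFun (g i)) : IsPolyFun (fun x => F (fun i => g i x)) := by
  obtain ⟨Q, hQ⟩ := hF
  choose P hP using hg
  refine ⟨MvPolynomial.bind₁ P Q, fun x => ?_⟩
  have : (fun i => g i x) = fun i => MvPolynomial.eval x (P i) := funext fun i => hP i x
  simp only [hQ, this]
  exact (MvPolynomial.eval₂Hom_bind₁ _ _ _ _).symm

/-- Polynomial functions form a domain. -/
theorem exists_mul_ne_zero {g h : (τ → ℂ) → ℂ} (hg : IsPolyFun g) (hh : IsPolyFun h)
    (hg0 : ∃ x, g x ≠ 0) (hh0 : ∃ x, h x ≠ 0) : ∃ x, g x * h x ≠ 0 := by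
  obtain ⟨P, hP⟩ := hg
  obtain ⟨Q, hQ⟩ := hh
  by_contra! hc
  have : P * Q = 0 := MvPolynomial.funext fun x => by simpa [hP, hQ] using hc x
  obtain ⟨x, hx⟩ := hg0
  obtain ⟨y, hy⟩ := hh0
  rcases mul_eq_zero.1 this with h | h
  · exact hx (by rw [hP, h, map_zero])
  · exact hy (by rw [hQ, h, map_zero])

end IsPolyFun

namespace IsHomFun

theorem isPolyFun {d : ℕ} {g : (τ → ℂ) → ℂ} (hg : IsHomFun d g) : IsPolyFun g :=
  let ⟨P, _, hP⟩ := hg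
  ⟨P, hP⟩

theorem zero (d : ℕ) : IsHomFun d (fun _ : τ → ℂ => 0) :=
  ⟨0, MvPolynomial.isHomogeneous_zero _ _ _, fun x => by simp⟩

theorem const (r : ℂ) : IsHomFun 0 (fun _ : τ → ℂ => r) :=
  ⟨MvPolynomial.C r, MvPolynomial.isHomogeneous_C _ _, fun x => by simp⟩

theorem coord (i : τ) : IsHomFun 1 (fun x : τ → ℂ => x i) :=
  ⟨MvPolynomial.X i, MvPolynomial.isHomogeneous_X _ _, fun x => by simp⟩

theorem add {d : ℕ} {g h : (τ → ℂ) → ℂ} (hg : IsHomFun d g) (hh : IsHomFun d h) :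
    IsHomFun d (fun x => g x + h x) := by
  obtain ⟨P, hP', hP⟩ := hg
  obtain ⟨Q, hQ', hQ⟩ := hh
  exact ⟨P + Q, hP'.add hQ', fun x => by simp [hP, hQ]⟩

theorem sub {d : ℕ} {g h : (τ → ℂ) → ℂ} (hg : IsHomFun d g) (hh : IsHomFun d h) :
    IsHomFun d (fun x => g x - h x) := by
  obtain ⟨P, hP', hP⟩ := hg
  obtain ⟨Q, hQ', hQ⟩ := hh
  exact ⟨P - Q, hP'.sub hQ', fun x => by simp [hP, hQ]⟩

theorem mul {d e : ℕ} {g h : (τ → ℂ) → ℂ} (hg : IsHomFun d g) (hh : IsHomFun e h) :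
    IsHomFun (d + e) (fun x => g x * h x) := by
  obtain ⟨P, hP', hP⟩ := hg
  obtain ⟨Q, hQ', hQ⟩ := hh
  exact ⟨P * Q, hP'.mul hQ', fun x => by simp [hP, hQ]⟩

theorem const_mul {d : ℕ} (r : ℂ) {g : (τ → ℂ) → ℂ} (hg : IsHomFun d g) :
    IsHomFun d (fun x => r * g x) := by
  simpa using (const r).mul hg

theorem sum {ι : Type*} {d : ℕ} (s : Finset ι) {g : ι → (τ → ℂ) → ℂ}
    (hg : ∀ i, IsHomFun d (g i)) : IsHomFun d (fun x => ∑ i ∈ s, g i x) := by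
  choose P hP' hP using hg
  exact ⟨∑ i ∈ s, P i, MvPolynomial.IsHomogeneous.sum _ _ _ fun i _ => hP' i,
    fun x => by simp [hP]⟩

theorem prod {ι : Type*} {d : ι → ℕ} (s : Finset ι) {g : ι → (τ → ℂ) → ℂ}
    (hg : ∀ i, IsHomFun (d i) (g i)) : IsHomFun (∑ i ∈ s, d i) (fun x => ∏ i ∈ s, g i x) := by
  choose P hP' hP using hg
  exact ⟨∏ i ∈ s, P i, MvPolynomial.IsHomogeneous.prod _ _ _ fun i _ => hP' i,
    fun x => by simp [hP]⟩

theorem comp {d e : ℕ} {F : (υ → ℂ) → ℂ} (hF : IsHomFun e F) {g : υ → (τ → ℂ) → ℂ}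
    (hg : ∀ i, IsHomFun d (g i)) : IsHomFun (d * e) (fun x => F (fun i => g i x)) := by
  obtain ⟨Q, hQ', hQ⟩ := hF
  choose P hP' hP using hg
  refine ⟨MvPolynomial.aeval P Q, hQ'.aeval _ hP', fun x => ?_⟩
  have : (fun i => g i x) = fun i => MvPolynomial.eval x (P i) := funext fun i => hP i x
  simp only [hQ, this]
  exact (MvPolynomial.eval₂Hom_bind₁ _ _ _ _).symm

theorem linear [Fintype τ] [DecidableEq τ] (g : (τ → ℂ) →ₗ[ℂ] ℂ) : IsHomFun 1 (fun x => g x) := by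
  have : (fun x => g x) = fun x : τ → ℂ => ∑ i, g (Pi.single i 1) * x i := by
    funext x
    conv_lhs => rw [pi_eq_sum_univ' x, map_sum]
    refine Finset.sum_congr rfl fun i _ => ?_
    rw [map_smul, smul_eq_mul, mul_comm]
  rw [this]
  exact sum _ fun i => (coord i).const_mul _

theorem det {n : Type*} [Fintype n] [DecidableEq n] {d : n → ℕ} {M : n → n → (τ → ℂ) → ℂ}
    (hM : ∀ i j, IsHomFun (d i) (M i j)) :
    IsHomFun (∑ i, d i) (fun x => Matrix.det (Matrix.of fun i j => M i j x)) := by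
  simp only [Matrix.det_apply, Matrix.of_apply]
  refine sum _ fun σ => ?_
  have h := prod Finset.univ (fun i => hM (σ i) i)
  -- Each Leibniz term uses every row exactly once, so all terms have the same degree.
  rw [Equiv.sum_comp σ d] at h
  simpa [Units.smul_def, zsmul_eq_mul] using h.const_mul ((Equiv.Perm.sign σ : ℤ) : ℂ)

end IsHomFun

end PolynomialFunctions

/-! ### Elimination theory for homogeneous systems -/

section Elimination

open MvPolynomial

variable {σ τ J : Type*}

/-- Projective Nullstellensatz: a homogeneous system with no nontrivial zero generates all forms
of some positive degree. -/
theorem exists_degree_forall_mem_span [Finite σ] (e : J → MvPolynomial σ ℂ)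
    (h : ∀ w : σ → ℂ, (∀ j, eval w (e j) = 0) → w = 0) :
    ∃ n : ℕ, 0 < n ∧ ∀ F : MvPolynomial σ ℂ, F.IsHomogeneous n →
      F ∈ Ideal.span (Set.range e) := by
  set I := Ideal.span (Set.range e) with hI
  -- The zero locus is contained in the origin, so by the Nullstellensatz every variable lies in the
  -- radical, and a power of the irrelevant ideal lies in I.
  have hle : Ideal.span (Set.range (X : σ → MvPolynomial σ ℂ)) ≤ I.radical := by
    rw [Ideal.span_le, ← vanishingIdeal_zeroLocus_eq_radical (K := ℂ)]
    rintro _ ⟨i, rfl⟩ w hw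
    rw [hI, zeroLocus_span] at hw
    have := h w fun j => by simpa using hw (e j) ⟨j, rfl⟩
    simp [this]
  obtain ⟨n, hn⟩ := Ideal.exists_pow_le_of_le_radical_of_fg hle
    ⟨(Set.finite_range X).toFinset, by simp⟩
  -- The exponent is raised by one only to make it positive.
  refine ⟨n + 1, Nat.succ_pos _, fun F hF => hn (Ideal.pow_le_pow_right n.le_succ ?_)⟩
  rw [Ideal.mem_span_pow_iff_exists_isHomogeneous]
  refine ⟨map C F, hF.map _, ?_⟩
  rw [eval_map]
  exact eval₂_eta F

/-- The coefficients of degree `n`. -/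
def coeffVec (n : ℕ) : MvPolynomial σ ℂ →ₗ[ℂ] ({k : σ →₀ ℕ // k.degree = n} → ℂ) where
  toFun F k := coeff k.1 F
  map_add' _ _ := rfl
  map_smul' _ _ := rfl

/-- Elimination: having no nontrivial zero is a Zariski open condition on the parameters of a
homogeneous system. -/
theorem exists_polynomials_iff_only_zero [Finite σ] (e : J → (τ → ℂ) → MvPolynomial σ ℂ) (d m : J → ℕ)
    (he : ∀ j c, (e j c).IsHomogeneous (d j))
    (hc : ∀ j k, IsHomFun (m j) (fun c => coeff k (e j c))) :
    ∃ S : Set (MvPolynomial τ ℂ), (∀ F ∈ S, ∃ n, F.IsHomogeneous n) ∧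
      ∀ c, (∃ F ∈ S, eval c F ≠ 0) ↔ ∀ w : σ → ℂ, (∀ j, eval w (e j c) = 0) → w = 0 := by
  classical
  have hfin : ∀ n : ℕ, Finite {k : σ →₀ ℕ // k.degree = n} := fun n =>
    (Finsupp.finite_of_degree_eq n).to_subtype
  let inst : ∀ n : ℕ, Fintype {k : σ →₀ ℕ // k.degree = n} := fun n => Fintype.ofFinite _
  let M : ∀ n : ℕ, ({k : σ →₀ ℕ // k.degree = n} → J × (σ →₀ ℕ)) → (τ → ℂ) →
      Matrix {k : σ →₀ ℕ // k.degree = n} {k : σ →₀ ℕ // k.degree = n} ℂ := fun n g c =>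
    Matrix.of fun k l => coeff l.1 (monomial (g k).2 1 * e (g k).1 c)
  -- The forms are the maximal minors of the Macaulay matrices: rows are monomial multiples of the
  -- equations, columns are the monomials of degree n > 0. A nonzero minor means that the multiples
  -- span all forms of degree n.
  refine ⟨{F | (∃ d, F.IsHomogeneous d) ∧ ∃ n, 0 < n ∧ ∃ g, ∀ c, eval c F = (M n g c).det},
    fun F hF => hF.1, fun c => ⟨?_, fun h => ?_⟩⟩
  · rintro ⟨F, ⟨-, n, hn, g, hg⟩, hF⟩ w hw
    rw [hg] at hF
    -- A row of the wrong degree has no coefficients in degree n and would make the minor zero.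
    have hdeg : ∀ k, (g k).2.degree + d (g k).1 = n := by
      intro k
      by_contra hk
      refine hF (Matrix.det_eq_zero_of_row_eq_zero k fun l => ?_)
      have hhom : (monomial (g k).2 (1 : ℂ) * e (g k).1 c).IsHomogeneous _ :=
        (isHomogeneous_monomial 1 rfl).mul (he _ _)
      exact hhom.coeff_eq_zero (by rw [l.2]; exact fun h => hk h.symm)
    funext i
    let k0 : {k : σ →₀ ℕ // k.degree = n} := ⟨Finsupp.single i n, by simp⟩
    -- Inverting the matrix writes the n-th power of the i-th variable as a combination of the rows;
    -- evaluating at a common zero w then gives w i = 0.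
    let x := Matrix.vecMul (Pi.single k0 1) (M n g c)⁻¹
    have hx : Matrix.vecMul x (M n g c) = Pi.single k0 1 := by
      rw [Matrix.vecMul_vecMul, Matrix.nonsing_inv_mul _ (isUnit_iff_ne_zero.2 hF),
        Matrix.vecMul_one]
    have hhom : (∑ k, C (x k) * (monomial (g k).2 1 * e (g k).1 c)).IsHomogeneous n := by
      refine IsHomogeneous.sum _ _ _ fun k _ => IsHomogeneous.C_mul ?_ _
      rw [← hdeg k]
      exact (isHomogeneous_monomial 1 rfl).mul (he _ _)
    have heq : monomial (Finsupp.single i n) 1 =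
        ∑ k, C (x k) * (monomial (g k).2 1 * e (g k).1 c) := by
      ext l
      by_cases hl : l.degree = n
      · have := congrFun hx ⟨l, hl⟩
        simp only [Matrix.vecMul, dotProduct, M, Matrix.of_apply] at this
        rw [coeff_sum]
        simp only [coeff_C_mul]
        rw [this, coeff_monomial, Pi.single_apply]
        simp [k0, eq_comm]
      · rw [hhom.coeff_eq_zero hl,
          (isHomogeneous_monomial (1 : ℂ) (by simp : (Finsupp.single i n).degree = n)).coeff_eq_zero
            hl]
    have := congrArg (eval w) heq
    simp only [map_sum, map_mul, hw, mul_zero, Finset.sum_const_zero, eval_monomial] at this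
    simpa [hn.ne'] using this
  · obtain ⟨n, hn, hI⟩ := exists_degree_forall_mem_span (fun j => e j c) h
    let v : J × (σ →₀ ℕ) → ({k : σ →₀ ℕ // k.degree = n} → ℂ) := fun p =>
      coeffVec n (monomial p.2 1 * e p.1 c)
    have hspan : Submodule.span ℂ (Set.range v) = ⊤ := by
      -- The extra multiplier a absorbs the coefficients in the ideal-span induction.
      have key : ∀ F ∈ Ideal.span (Set.range fun j => e j c), ∀ a : MvPolynomial σ ℂ,
          coeffVec n (a * F) ∈ Submodule.span ℂ (Set.range v) := by
        intro F hF
        induction hF using Submodule.span_induction with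
        | mem F hF =>
          obtain ⟨j, rfl⟩ := hF
          intro a
          induction a using MvPolynomial.induction_on' with
          | monomial k r =>
            have : monomial k r * e j c = r • (monomial k 1 * e j c) := by
              rw [← smul_mul_assoc, smul_monomial, smul_eq_mul, mul_one]
            rw [this, map_smul]
            exact Submodule.smul_mem _ _ (Submodule.subset_span ⟨(j, k), rfl⟩)
          | add p q hp hq =>
            rw [add_mul, map_add]
            exact Submodule.add_mem _ hp hq
        | zero => intro a; simp
        | add F G _ _ hF hG =>
          intro a
          rw [mul_add, map_add]
          exact Submodule.add_mem _ (hF a) (hG a)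
        | smul b F _ hF =>
          intro a
          rw [smul_eq_mul, ← mul_assoc]
          exact hF _
      rw [eq_top_iff, ← (Pi.basisFun ℂ _).span_eq, Submodule.span_le]
      rintro _ ⟨k, rfl⟩
      have := key _ (hI (monomial k.1 1) (isHomogeneous_monomial 1 k.2)) 1
      rw [one_mul] at this
      have hk : Pi.basisFun ℂ _ k = coeffVec n (monomial k.1 (1 : ℂ)) := by
        funext l
        change _ = coeff l.1 (monomial k.1 1)
        simp [coeff_monomial, Pi.single_apply, Subtype.ext_iff, eq_comm]
      rw [hk]
      exact this
    -- The rows span, so a basis can be chosen among them; it gives an invertible square submatrix.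
    obtain ⟨κ, a, ha, hspan', hli⟩ := exists_linearIndependent' ℂ v
    rw [hspan] at hspan'
    let b := Module.Basis.mk hli hspan'.ge
    let φ := b.indexEquiv (Pi.basisFun ℂ {k : σ →₀ ℕ // k.degree = n})
    let g := fun k => a (φ.symm k)
    have hdet : (M n g c).det ≠ 0 := by
      rw [← isUnit_iff_ne_zero, ← Matrix.isUnit_iff_isUnit_det,
        ← Matrix.linearIndependent_rows_iff_isUnit]
      exact hli.comp _ φ.symm.injective
    have hhom : IsHomFun (∑ k, m (g k).1) fun c => (M n g c).det := by
      refine IsHomFun.det fun k l => ?_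
      simp only [coeff_monomial_mul']
      split_ifs
      · simpa using hc _ _
      · exact IsHomFun.zero _
    obtain ⟨P, hP', hP⟩ := hhom
    exact ⟨P, ⟨⟨_, hP'⟩, n, hn, g, fun c => (hP c).symm⟩, by rw [← hP]; exact hdet⟩

attribute [local instance] MvPolynomial.gradedAlgebra in
/-- If a homogeneous system has no nontrivial zero on a hyperplane, then it has finitely many
zeros off the hyperplane, up to scalars. -/
theorem finite_zeros_off_hyperplane [Finite σ] (e : J → MvPolynomial σ ℂ) (d : J → ℕ)
    (he : ∀ j, (e j).IsHomogeneous (d j)) (H : MvPolynomial σ ℂ) (hH : H.IsHomogeneous 1)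
    (h : ∀ w : σ → ℂ, (∀ j, eval w (e j) = 0) → eval w H = 0 → w = 0) :
    {w : σ → ℂ | (∀ j, eval w (e j) = 0) ∧ eval w H = 1}.Finite := by
  classical
  set Y := {w : σ → ℂ | (∀ j, eval w (e j) = 0) ∧ eval w H = 1} with hY
  obtain ⟨n, hn, hI⟩ := exists_degree_forall_mem_span (Sum.elim e fun _ : Unit => H)
    (fun w hw => h w (fun j => hw (Sum.inl j)) (hw (Sum.inr ())))
  set I := Ideal.span (Set.range e)
  have hIhom : I.IsHomogeneous (homogeneousSubmodule σ ℂ) := by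
    apply Ideal.homogeneous_span
    rintro _ ⟨j, rfl⟩
    exact ⟨_, he j⟩
  have hIY : ∀ F ∈ I, ∀ w ∈ Y, eval w F = 0 := by
    intro F hF w hw
    have : I ≤ RingHom.ker (eval w) := Ideal.span_le.2 (by rintro _ ⟨j, rfl⟩; exact hw.1 j)
    exact this hF
  -- A form of degree n is congruent to g * H modulo I. On Y, where H = 1, it therefore agrees with
  -- the part of g of degree n - 1.
  have hred : ∀ F : MvPolynomial σ ℂ, F.IsHomogeneous n → ∃ G : MvPolynomial σ ℂ,
      G.IsHomogeneous (n - 1) ∧ ∀ w ∈ Y, eval w F = eval w G := by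
    intro F hF
    have := hI F hF
    rw [Set.Sum.elim_range, Ideal.span_union, Set.range_const, Submodule.mem_sup] at this
    obtain ⟨u, hu, v, hv, huv⟩ := this
    obtain ⟨g, rfl⟩ := Ideal.mem_span_singleton'.1 hv
    refine ⟨homogeneousComponent (n - 1) g, homogeneousComponent_isHomogeneous _ _,
      fun w hw => ?_⟩
    have h1 := congrArg (homogeneousComponent n) huv
    rw [homogeneousComponent_of_mem hF, if_pos rfl, map_add] at h1
    have h2 : homogeneousComponent n (g * H) = homogeneousComponent (n - 1) g * H := by
      conv_lhs => rw [← sum_homogeneousComponent g, Finset.sum_mul, map_sum]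
      have : ∀ i, homogeneousComponent n (homogeneousComponent i g * H) =
          if n - 1 = i then homogeneousComponent (n - 1) g * H else 0 := by
        intro i
        rw [homogeneousComponent_of_mem (((homogeneousComponent_isHomogeneous i g).mul hH))]
        by_cases hi : n - 1 = i
        · rw [if_pos (by omega), if_pos hi, hi]
        · rw [if_neg (by omega), if_neg hi]
      simp only [this, Finset.sum_ite_eq, Finset.mem_range]
      split_ifs with hlt
      · rfl
      · rw [homogeneousComponent_eq_zero _ _ (by omega), zero_mul]
    rw [← h1, map_add, hIY _ (homogeneousComponent_mem_of_mem hIhom hu n) w hw, h2, map_mul, hw.2]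
    simp
  -- The image of ρ is the ring of polynomial functions on Y. By the reduction it is spanned by
  -- monomials of degree below n, hence is finite-dimensional.
  let ρ : MvPolynomial σ ℂ →ₐ[ℂ] (Y → ℂ) := AlgHom.pi fun w => aeval w.1
  have hρ : ∀ F w, ρ F w = eval w.1 F := fun F w => by simp [ρ, aeval_eq_eval]
  let B : Set (Y → ℂ) := (fun k : σ →₀ ℕ => ρ (monomial k 1)) '' {k | k.degree < n}
  have hB : B.Finite := (Finsupp.finite_of_degree_lt n).image _
  have hhom : ∀ (N : ℕ) (F : MvPolynomial σ ℂ), F.IsHomogeneous N →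
      (∀ k : σ →₀ ℕ, k.degree ≤ N → ρ (monomial k 1) ∈ Submodule.span ℂ B) →
      ρ F ∈ Submodule.span ℂ B := by
    intro N F hF hk
    rw [F.as_sum, map_sum]
    refine Submodule.sum_mem _ fun k hkF => ?_
    have : monomial k (coeff k F) = coeff k F • monomial k (1 : ℂ) := by
      rw [smul_monomial, smul_eq_mul, mul_one]
    rw [this, map_smul]
    refine Submodule.smul_mem _ _ (hk k ?_)
    by_contra hlt
    exact (mem_support_iff.1 hkF) (hF.coeff_eq_zero (by omega))
  have hmon : ∀ (N : ℕ) (k : σ →₀ ℕ), k.degree ≤ N → ρ (monomial k 1) ∈ Submodule.span ℂ B := by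
    intro N
    induction N with
    | zero => exact fun k hk => Submodule.subset_span ⟨k, by simp only [Set.mem_ofPred_eq]; omega, rfl⟩
    | succ N ih =>
      intro k hk
      by_cases hlt : k.degree < n
      · exact Submodule.subset_span ⟨k, hlt, rfl⟩
      obtain ⟨k', hk'le, hk'⟩ : ∃ k' ≤ k, k'.degree = n :=
        Finsupp.exists_le_degree_eq k n (not_lt.1 hlt)
      obtain ⟨G, hG, hGY⟩ := hred (monomial k' 1) (isHomogeneous_monomial 1 hk')
      have hdeg : (k - k').degree + k'.degree = k.degree := by
        rw [← map_add, tsub_add_cancel_of_le hk'le]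
      have : ρ (monomial k 1) = ρ (monomial (k - k') 1 * G) := by
        funext w
        rw [map_mul, Pi.mul_apply, hρ _ w, hρ _ w, hρ _ w, ← hGY w.1 w.2, ← map_mul, monomial_mul,
          tsub_add_cancel_of_le hk'le, one_mul]
      rw [this]
      have hmul := (isHomogeneous_monomial (1 : ℂ) (rfl : (k - k').degree = _)).mul hG
      exact hhom _ _ hmul fun l hl => ih l (by omega)
  have hrange : Subalgebra.toSubmodule ρ.range = Submodule.span ℂ B := by
    refine le_antisymm ?_ ?_
    · rintro _ ⟨F, rfl⟩
      change ρ F ∈ _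
      rw [← sum_homogeneousComponent F, map_sum]
      exact Submodule.sum_mem _ fun i _ =>
        hhom i _ (homogeneousComponent_isHomogeneous _ _) (hmon i)
    · rw [Submodule.span_le]
      rintro _ ⟨k, -, rfl⟩
      exact ⟨_, rfl⟩
  have : FiniteDimensional ℂ ρ.range := by
    have : FiniteDimensional ℂ (Submodule.span ℂ B) := FiniteDimensional.span_of_finite ℂ hB
    rw [← hrange] at this
    exact this
  -- Points of Y are characters of a finite-dimensional algebra, and such an algebra has finitely
  -- many.
  let ev : Y → (ρ.range →ₐ[ℂ] ℂ) := fun w => (Pi.evalAlgHom ℂ (fun _ : Y => ℂ) w).comp ρ.range.val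
  have hev : Function.Injective ev := by
    intro w w' hww
    ext i
    have := DFunLike.congr_fun hww ⟨ρ (X i), ⟨X i, rfl⟩⟩
    simpa [ev, hρ] using this
  exact Set.finite_coe_iff.1 (Finite.of_injective ev hev)

end Elimination

/-! ### Coefficients of ruling maps -/

theorem pluckerVec_add_left (a a' b : Fin 6 → ℂ) :
    pluckerVec (a + a') b = pluckerVec a b + pluckerVec a' b := by
  funext p
  simp only [pluckerVec, Pi.add_apply]
  ring

theorem pluckerVec_add_right (a b b' : Fin 6 → ℂ) :
    pluckerVec a (b + b') = pluckerVec a b + pluckerVec a b' := by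
  funext p
  simp only [pluckerVec, Pi.add_apply]
  ring

theorem pluckerVec_smul_left (r : ℂ) (a b : Fin 6 → ℂ) :
    pluckerVec (r • a) b = r • pluckerVec a b := by
  funext p
  simp only [pluckerVec, Pi.smul_apply, smul_eq_mul]
  ring

theorem pluckerVec_smul_right (r : ℂ) (a b : Fin 6 → ℂ) :
    pluckerVec a (r • b) = r • pluckerVec a b := by
  funext p
  simp only [pluckerVec, Pi.smul_apply, smul_eq_mul]
  ring

/-- The exterior product of two vectors as a bilinear map. -/
def wedge : (Fin 6 → ℂ) →ₗ[ℂ] (Fin 6 → ℂ) →ₗ[ℂ] (PIdx → ℂ) :=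
  LinearMap.mk₂ ℂ pluckerVec pluckerVec_add_left pluckerVec_smul_left pluckerVec_add_right
    pluckerVec_smul_right

theorem wedge_apply (a b : Fin 6 → ℂ) : wedge a b = pluckerVec a b := rfl

theorem wedge_self (a : Fin 6 → ℂ) : wedge a a = 0 := by
  funext p
  simp only [wedge_apply, pluckerVec, Pi.zero_apply]
  ring

theorem wedge_swap (a b : Fin 6 → ℂ) : wedge a b = -wedge b a := by
  funext p
  simp only [wedge_apply, pluckerVec, Pi.neg_apply]
  ring

/-! ### Alternating forms as linear functionals on Plücker space. -/

/-- The bilinear form with matrix `w`. -/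
def bil (w : Fin 6 × Fin 6 → ℂ) : (Fin 6 → ℂ) →ₗ[ℂ] (Fin 6 → ℂ) →ₗ[ℂ] ℂ :=
  LinearMap.mk₂ ℂ (fun a b => ∑ i, ∑ j, w (i, j) * a i * b j)
    (fun a a' b => by simp only [Pi.add_apply, mul_add, add_mul, Finset.sum_add_distrib])
    (fun r a b => by
      simp only [Pi.smul_apply, smul_eq_mul, Finset.mul_sum]
      exact Finset.sum_congr rfl fun i _ => Finset.sum_congr rfl fun j _ => by ring)
    (fun a b b' => by simp only [Pi.add_apply, mul_add, Finset.sum_add_distrib])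
    (fun r a b => by
      simp only [Pi.smul_apply, smul_eq_mul, Finset.mul_sum]
      exact Finset.sum_congr rfl fun i _ => Finset.sum_congr rfl fun j _ => by ring)

theorem bil_apply (w : Fin 6 × Fin 6 → ℂ) (a b : Fin 6 → ℂ) :
    bil w a b = ∑ i, ∑ j, w (i, j) * a i * b j := rfl

theorem bil_single (w : Fin 6 × Fin 6 → ℂ) (i j : Fin 6) :
    bil w (Pi.single i 1) (Pi.single j 1) = w (i, j) := by
  simp [bil_apply, Pi.single_apply]

/-- The contraction of a vector of Plücker coordinates with an alternating form. -/
def contract (w : Fin 6 × Fin 6 → ℂ) : (PIdx → ℂ) →ₗ[ℂ] ℂ where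
  toFun y := ∑ p : PIdx, w p.1 * y p
  map_add' y z := by simp [mul_add, Finset.sum_add_distrib]
  map_smul' r y := by
    simp only [Pi.smul_apply, smul_eq_mul, Finset.mul_sum, RingHom.id_apply]
    exact Finset.sum_congr rfl fun i _ => by ring

theorem contract_apply (w : Fin 6 × Fin 6 → ℂ) (y : PIdx → ℂ) :
    contract w y = ∑ p : PIdx, w p.1 * y p := rfl

theorem sum_PIdx (g : Fin 6 × Fin 6 → ℂ) :
    ∑ p : PIdx, g p.1 = ∑ i : Fin 6, ∑ j : Fin 6, if i < j then g (i, j) else 0 := by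
  rw [← Finset.sum_product', Finset.univ_product_univ, ← Finset.sum_filter]
  exact (Finset.sum_subtype _ (by simp) g).symm

/-- The contraction sums over i < j and the bilinear form over all pairs; alternation folds one sum
into the other. Hyperplanes of Plücker space can thus be handled as alternating forms. -/
theorem contract_wedge {w : Fin 6 × Fin 6 → ℂ} (h0 : ∀ i, w (i, i) = 0)
    (h1 : ∀ i j, w (i, j) = -w (j, i)) (a b : Fin 6 → ℂ) :
    contract w (wedge a b) = bil w a b := by
  have h : contract w (wedge a b) =
      ∑ i : Fin 6, ∑ j : Fin 6, if i < j then w (i, j) * (a i * b j - a j * b i) else 0 :=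
    sum_PIdx fun p => w p * (a p.1 * b p.2 - a p.2 * b p.1)
  rw [h, bil_apply]
  have h2 : ∑ i : Fin 6, ∑ j : Fin 6, (if i < j then w (i, j) * (a i * b j - a j * b i) else 0) =
      ∑ i : Fin 6, ∑ j : Fin 6, ((if i < j then w (i, j) * a i * b j else 0) +
        if j < i then w (i, j) * a i * b j else 0) := by
    simp only [Finset.sum_add_distrib]
    rw [Finset.sum_comm (f := fun i j : Fin 6 => if j < i then w (i, j) * a i * b j else 0)]
    simp only [← Finset.sum_add_distrib]
    refine Finset.sum_congr rfl fun i _ => Finset.sum_congr rfl fun j _ => ?_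
    split_ifs
    · rw [h1 j i]
      ring
    · simp
  rw [h2]
  refine Finset.sum_congr rfl fun i _ => Finset.sum_congr rfl fun j _ => ?_
  rcases lt_trichotomy i j with h | h | h
  · simp [h, h.not_gt]
  · simp [h, h0]
  · simp [h, h.not_gt]

theorem bil_self {w : Fin 6 × Fin 6 → ℂ} (h0 : ∀ i, w (i, i) = 0)
    (h1 : ∀ i j, w (i, j) = -w (j, i)) (a : Fin 6 → ℂ) : bil w a a = 0 := by
  rw [← contract_wedge h0 h1, wedge_self, map_zero]

theorem bil_swap {w : Fin 6 × Fin 6 → ℂ} (h0 : ∀ i, w (i, i) = 0)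
    (h1 : ∀ i j, w (i, j) = -w (j, i)) (a b : Fin 6 → ℂ) : bil w a b = -bil w b a := by
  rw [← contract_wedge h0 h1, wedge_swap, map_neg, contract_wedge h0 h1]

/-- The coordinate vectors of the 3-space of the cubic. -/
def cubicVec (i : Fin 4) : C9 := Pi.single (Sum.inl i) 1

/-- The coordinate vectors of the 4-space of the quartic. -/
def quarticVec (j : Fin 5) : C9 := Pi.single (Sum.inr j) 1

theorem cubicPt_eq_sum (v : Fin 2 → ℂ) : cubicPt v = ∑ i, veronese 3 v i • cubicVec i := by
  funext x
  rcases x with x | x <;> simp [cubicPt, cubicVec, Finset.sum_apply, Pi.single_apply]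

theorem quarticPt_eq_sum (v : Fin 2 → ℂ) : quarticPt v = ∑ i, veronese 4 v i • quarticVec i := by
  funext x
  rcases x with x | x <;> simp [quarticPt, quarticVec, Finset.sum_apply, Pi.single_apply]

/-- The coefficient of index `k` of a product of a cubic and a quartic form. -/
def antidiagSum {E : Type*} [AddCommMonoid E] (k : Fin 8) (g : Fin 4 → Fin 5 → E) : E :=
  ∑ i : Fin 4, ∑ j : Fin 5, if (i : ℕ) + (j : ℕ) = (k : ℕ) then g i j else 0

/-- The i-th cubic monomial times the j-th quartic monomial is the septic monomial of index i + j.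
-/
theorem sum_veronese_smul_antidiagSum {E : Type*} [AddCommGroup E] [Module ℂ E]
    (g : Fin 4 → Fin 5 → E) (v : Fin 2 → ℂ) :
    ∑ k, veronese 7 v k • antidiagSum k g =
      ∑ i, ∑ j, veronese 3 v i • veronese 4 v j • g i j := by
  simp only [antidiagSum, Finset.smul_sum]
  rw [Finset.sum_comm]
  refine Finset.sum_congr rfl fun i _ => ?_
  rw [Finset.sum_comm]
  refine Finset.sum_congr rfl fun j _ => ?_
  have hlt : (i : ℕ) + j < 8 := by omega
  rw [Finset.sum_eq_single (⟨(i : ℕ) + j, hlt⟩ : Fin 8)]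
  · rw [if_pos rfl, smul_smul]
    congr 1
    simp only [veronese]
    rw [show 7 - ((i : ℕ) + j) = (3 - i) + (4 - j) by omega, pow_add, pow_add]
    ring
  · intro k _ hk
    rw [if_neg fun h => hk (Fin.ext h.symm), smul_zero]
  · simp

/-- The coefficients of the map of rulings of the projection of the scroll with matrix `M`. -/
def projCoeffs (M : C9 →ₗ[ℂ] (Fin 6 → ℂ)) : Coeffs :=
  fun q => antidiagSum q.2 (fun i j => wedge (M (cubicVec i)) (M (quarticVec j))) q.1

/-- The coefficient vectors of a tuple of forms. -/
def coeffCol (c : Coeffs) (k : Fin 8) : PIdx → ℂ := fun p => c (p, k)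

theorem coeffCol_projCoeffs (M : C9 →ₗ[ℂ] (Fin 6 → ℂ)) (k : Fin 8) :
    coeffCol (projCoeffs M) k =
      antidiagSum k (fun i j => wedge (M (cubicVec i)) (M (quarticVec j))) := rfl

/-- The linear map on `ℂ⁸` that sends the rational normal curve to the curve of values. -/
def coeffMap (c : Coeffs) : (Fin 8 → ℂ) →ₗ[ℂ] (PIdx → ℂ) where
  toFun x := ∑ k, x k • coeffCol c k
  map_add' x y := by simp [add_smul, Finset.sum_add_distrib]
  map_smul' r x := by simp [mul_smul, Finset.smul_sum]

theorem coeffMap_apply (c : Coeffs) (x : Fin 8 → ℂ) : coeffMap c x = ∑ k, x k • coeffCol c k := rfl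

theorem evalVec_eq_coeffMap (c : Coeffs) (v : Fin 2 → ℂ) :
    evalVec c v = coeffMap c (veronese 7 v) := by
  funext p
  simp only [evalVec, form, map_sum, map_mul, MvPolynomial.eval_C, map_pow, MvPolynomial.eval_X,
    coeffMap_apply, Finset.sum_apply, Pi.smul_apply, smul_eq_mul, veronese, coeffCol]
  exact Finset.sum_congr rfl fun k _ => mul_comm _ _

/-- This justifies `projCoeffs`: its values are Plücker vectors of the projected rulings. -/
theorem evalVec_projCoeffs (M : C9 →ₗ[ℂ] (Fin 6 → ℂ)) (v : Fin 2 → ℂ) :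
    evalVec (projCoeffs M) v = wedge (M (cubicPt v)) (M (quarticPt v)) := by
  rw [evalVec_eq_coeffMap, coeffMap_apply]
  simp only [coeffCol_projCoeffs]
  rw [sum_veronese_smul_antidiagSum, cubicPt_eq_sum, quarticPt_eq_sum]
  simp only [map_sum, map_smul, LinearMap.sum_apply, LinearMap.smul_apply, Finset.smul_sum]
  rw [Finset.sum_comm]
  exact Finset.sum_congr rfl fun j _ => Finset.sum_congr rfl fun i _ => smul_comm _ _ _

theorem map_antidiagSum {E E' : Type*} [AddCommGroup E] [Module ℂ E] [AddCommGroup E']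
    [Module ℂ E'] (φ : E →ₗ[ℂ] E') (k : Fin 8) (g : Fin 4 → Fin 5 → E) :
    φ (antidiagSum k g) = antidiagSum k (fun i j => φ (g i j)) := by
  simp only [antidiagSum, map_sum, apply_ite φ, map_zero]

theorem contract_coeffCol_projCoeffs {w : Fin 6 × Fin 6 → ℂ} (h0 : ∀ i, w (i, i) = 0)
    (h1 : ∀ i j, w (i, j) = -w (j, i)) (M : C9 →ₗ[ℂ] (Fin 6 → ℂ)) (k : Fin 8) :
    contract w (coeffCol (projCoeffs M) k) =
      antidiagSum k (fun i j => bil w (M (cubicVec i)) (M (quarticVec j))) := by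
  rw [coeffCol_projCoeffs, map_antidiagSum]
  simp only [contract_wedge h0 h1]

/-! ### Veronese vectors -/

theorem veronese_smul (d : ℕ) (r : ℂ) (v : Fin 2 → ℂ) : veronese d (r • v) = r ^ d • veronese d v := by
  funext i
  simp only [veronese, Pi.smul_apply, smul_eq_mul, mul_pow]
  have : r ^ d = r ^ (d - (i : ℕ)) * r ^ (i : ℕ) := by
    rw [← pow_add, Nat.sub_add_cancel (Nat.lt_succ_iff.1 i.2)]
  rw [this]
  ring

theorem veronese_ne_zero (d : ℕ) {v : Fin 2 → ℂ} (hv : v ≠ 0) : veronese d v ≠ 0 := by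
  intro h
  apply hv
  have h0 := congrFun h 0
  have h1 := congrFun h (Fin.last d)
  simp only [veronese, Fin.val_zero, Nat.sub_zero, pow_zero, mul_one, Pi.zero_apply,
    Fin.val_last, Nat.sub_self, one_mul, pow_eq_zero_iff', ne_eq] at h0 h1
  funext i
  fin_cases i
  · exact h0.1
  · exact h1.1

theorem eq_zero_of_sum_pow_eq_zero {d : ℕ} {x : Fin (d + 1) → ℂ}
    (h : ∀ t : ℂ, ∑ k, x k * t ^ (k : ℕ) = 0) : x = 0 := by
  have hp : ∑ k : Fin (d + 1), Polynomial.C (x k) * Polynomial.X ^ (k : ℕ) = 0 :=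
    Polynomial.funext fun t => by simpa [Polynomial.eval_finsetSum] using h t
  funext k
  have := congrArg (Polynomial.coeff · (k : ℕ)) hp
  simpa [Polynomial.finsetSum_coeff, Polynomial.coeff_X_pow, Fin.val_inj] using this

theorem eq_zero_of_sum_veronese_eq_zero {d : ℕ} {x : Fin (d + 1) → ℂ}
    (h : ∀ v : Fin 2 → ℂ, v ≠ 0 → ∑ k, x k * veronese d v k = 0) : x = 0 := by
  refine eq_zero_of_sum_pow_eq_zero fun t => ?_
  have := h ![1, t] fun h => one_ne_zero (congrFun h 0)
  simpa [veronese] using this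

/-- The rational normal curve is nondegenerate: a functional vanishing on it is a binary form with
only zero values. -/
theorem eq_top_of_veronese_mem {d : ℕ} {N : Submodule ℂ (Fin (d + 1) → ℂ)}
    (h : ∀ v : Fin 2 → ℂ, v ≠ 0 → veronese d v ∈ N) : N = ⊤ := by
  by_contra hN
  obtain ⟨φ, hφ, hφN⟩ := Submodule.exists_le_ker_of_lt_top N (lt_top_iff_ne_top.2 hN)
  refine hφ (LinearMap.pi_ext' fun k => LinearMap.ext_ring ?_)
  have hx : (fun k => φ (Pi.single k 1)) = 0 := by
    refine eq_zero_of_sum_veronese_eq_zero fun v hv => ?_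
    have := hφN (h v hv)
    rw [LinearMap.mem_ker, LinearMap.pi_apply_eq_sum_univ] at this
    rw [← this]
    refine Finset.sum_congr rfl fun k _ => ?_
    rw [smul_eq_mul, mul_comm]
    congr 2
    ext j
    simp [Pi.single_apply, eq_comm]
  simpa using congrFun hx k

theorem rep_mk_eq_smul {ι : Type} {v : ι → ℂ} (hv : v ≠ 0) :
    ∃ r : ℂ, r ≠ 0 ∧ (Projectivization.mk ℂ v hv).rep = r • v := by
  obtain ⟨a, ha⟩ := Projectivization.exists_smul_eq_mk_rep ℂ v hv
  exact ⟨a, a.ne_zero, ha.symm⟩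

/-! ### The image curve when the coefficient vectors are linearly independent -/

theorem mem_imageCurve_iff {f : ℙ ℂ Coeffs} {y : P14} : y ∈ imageCurve f ↔ ∃ v : Fin 2 → ℂ, v ≠ 0 ∧
    ∃ h : coeffMap f.rep (veronese 7 v) ≠ 0,
      y = Projectivization.mk ℂ (coeffMap f.rep (veronese 7 v)) h := by
  constructor
  · rintro ⟨x, h, hy⟩
    refine ⟨x.rep, x.rep_nonzero, by rwa [evalVec_eq_coeffMap] at h, ?_⟩
    simpa only [evalVec_eq_coeffMap] using hy
  · rintro ⟨v, hv, h, rfl⟩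
    obtain ⟨r, hr, hrep⟩ := rep_mk_eq_smul hv
    have heq : evalVec f.rep (Projectivization.mk ℂ v hv).rep =
        r ^ 7 • coeffMap f.rep (veronese 7 v) := by
      rw [evalVec_eq_coeffMap, hrep, veronese_smul, map_smul]
    refine ⟨Projectivization.mk ℂ v hv, by rw [heq]; exact smul_ne_zero (pow_ne_zero _ hr) h, ?_⟩
    rw [Projectivization.mk_eq_mk_iff']
    exact ⟨(r ^ 7)⁻¹, by rw [heq, smul_smul, inv_mul_cancel₀ (pow_ne_zero _ hr), one_smul]⟩

section Injective

variable {f : ℙ ℂ Coeffs} (hf : Function.Injective (coeffMap f.rep))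
include hf

theorem coeffMap_veronese_ne_zero {v : Fin 2 → ℂ} (hv : v ≠ 0) :
    coeffMap f.rep (veronese 7 v) ≠ 0 := fun h =>
  veronese_ne_zero 7 hv (hf (h.trans (map_zero _).symm))

theorem isRationalNormalCurve_imageCurve : IsRationalNormalCurve 7 (imageCurve f) :=
  ⟨coeffMap f.rep, hf, Set.ext fun _ => mem_imageCurve_iff⟩

theorem linSpan_imageCurve : linSpan (imageCurve f) = LinearMap.range (coeffMap f.rep) := by
  refine le_antisymm (iSup₂_le fun y hy => ?_) ?_
  · obtain ⟨v, -, h, rfl⟩ := mem_imageCurve_iff.1 hy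
    rw [Projectivization.submodule_mk, Submodule.span_singleton_le_iff_mem]
    exact ⟨_, rfl⟩
  · rw [LinearMap.range_eq_map, Submodule.map_le_iff_le_comap, top_le_iff]
    refine eq_top_of_veronese_mem fun v hv => ?_
    have h := coeffMap_veronese_ne_zero hf hv
    refine le_iSup₂_of_le (f := fun (x : P14) (_ : x ∈ imageCurve f) => x.submodule)
      _ (mem_imageCurve_iff.2 ⟨v, hv, h, rfl⟩) le_rfl ?_
    rw [Projectivization.submodule_mk]
    exact Submodule.mem_span_singleton_self _

theorem finrank_linSpan_imageCurve : Module.finrank ℂ (linSpan (imageCurve f)) = 7 + 1 := by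
  rw [linSpan_imageCurve hf, LinearMap.finrank_range_of_inj hf, Module.finrank_fin_fun]

end Injective

/-! ### Decomposable alternating forms and `W¹` -/

/-- `w` is the matrix of a decomposable alternating form: it is alternating and satisfies the
Plücker relations. -/
structure IsDecomposable (w : Fin 6 × Fin 6 → ℂ) : Prop where
  diag : ∀ i, w (i, i) = 0
  swap : ∀ i j, w (i, j) = -w (j, i)
  plucker : ∀ i j k l, w (i, j) * w (k, l) - w (i, k) * w (j, l) + w (i, l) * w (j, k) = 0

/-- There is a hyperplane that contains no decomposable alternating form vanishing on the values
of the tuple `c`. -/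
def HasAvoidingHyperplane (c : Coeffs) : Prop :=
  ∃ H : Fin 6 × Fin 6 → ℂ, ∀ w, IsDecomposable w → (∀ k, contract w (coeffCol c k) = 0) →
    ∑ q, H q * w q = 0 → w = 0

/-! ### Genericity as nonvanishing of forms in the coefficients. -/

section Systems

open MvPolynomial

/-- The equations of decomposable alternating forms. -/
def decomposableRel : Fin 6 ⊕ (Fin 6 × Fin 6) ⊕ (Fin 6 × Fin 6 × Fin 6 × Fin 6) →
    MvPolynomial (Fin 6 × Fin 6) ℂ
  | .inl i => X (i, i)
  | .inr (.inl (i, j)) => X (i, j) + X (j, i)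
  | .inr (.inr (i, j, k, l)) => X (i, j) * X (k, l) - X (i, k) * X (j, l) + X (i, l) * X (j, k)

/-- The degrees of the equations of decomposable alternating forms. -/
def decomposableDeg : Fin 6 ⊕ (Fin 6 × Fin 6) ⊕ (Fin 6 × Fin 6 × Fin 6 × Fin 6) → ℕ
  | .inl _ => 1
  | .inr (.inl _) => 1
  | .inr (.inr _) => 1 + 1

theorem isHomogeneous_decomposableRel (j) :
    (decomposableRel j).IsHomogeneous (decomposableDeg j) := by
  rcases j with i | ⟨i, j⟩ | ⟨i, j, k, l⟩
  · exact isHomogeneous_X _ _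
  · exact (isHomogeneous_X _ _).add (isHomogeneous_X _ _)
  · exact (((isHomogeneous_X _ _).mul (isHomogeneous_X _ _)).sub
      ((isHomogeneous_X _ _).mul (isHomogeneous_X _ _))).add
      ((isHomogeneous_X _ _).mul (isHomogeneous_X _ _))

theorem forall_eval_decomposableRel_iff {w : Fin 6 × Fin 6 → ℂ} :
    (∀ j, eval w (decomposableRel j) = 0) ↔ IsDecomposable w := by
  constructor
  · intro h
    exact ⟨fun i => by simpa [decomposableRel] using h (.inl i),
      fun i j => eq_neg_of_add_eq_zero_left <| by
        simpa [decomposableRel] using h (.inr (.inl (i, j))),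
      fun i j k l => by simpa [decomposableRel] using h (.inr (.inr (i, j, k, l)))⟩
  · rintro ⟨h0, h1, h2⟩ (i | ⟨i, j⟩ | ⟨i, j, k, l⟩)
    · simpa [decomposableRel] using h0 i
    · simpa [decomposableRel] using eq_neg_iff_add_eq_zero.1 (h1 i j)
    · simpa [decomposableRel] using h2 i j k l

/-- The linear form with coefficients `a`. -/
def linForm {σ : Type*} [Fintype σ] (a : σ → ℂ) : MvPolynomial σ ℂ := ∑ i, C (a i) * X i

theorem isHomogeneous_linForm {σ : Type*} [Fintype σ] (a : σ → ℂ) :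
    (linForm a).IsHomogeneous 1 :=
  IsHomogeneous.sum _ _ _ fun i _ => isHomogeneous_C_mul_X (a i) i

theorem eval_linForm {σ : Type*} [Fintype σ] (a w : σ → ℂ) :
    eval w (linForm a) = ∑ i, a i * w i := by
  simp [linForm]

theorem isHomFun_coeff_linForm {σ τ : Type*} [Fintype σ] {m : ℕ} {a : σ → (τ → ℂ) → ℂ}
    (ha : ∀ i, IsHomFun m (a i)) (k : σ →₀ ℕ) :
    IsHomFun m (fun c => coeff k (linForm fun i => a i c)) := by
  classical
  simp only [linForm, coeff_sum, coeff_C_mul]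
  exact IsHomFun.sum _ fun i => by simpa only [mul_comm] using (ha i).const_mul (coeff k (X i))

/-- The equations of the decomposable forms vanishing on the values of the tuple `c`. -/
def apolarRel (c : Coeffs) :
    (Fin 6 ⊕ (Fin 6 × Fin 6) ⊕ (Fin 6 × Fin 6 × Fin 6 × Fin 6)) ⊕ Fin 8 →
      MvPolynomial (Fin 6 × Fin 6) ℂ :=
  Sum.elim decomposableRel fun k => linForm fun q =>
    if h : q.1 < q.2 then c (⟨q, h⟩, k) else 0

/-- The degrees of the equations of the decomposable forms vanishing on the values of a tuple. -/
def apolarDeg : (Fin 6 ⊕ (Fin 6 × Fin 6) ⊕ (Fin 6 × Fin 6 × Fin 6 × Fin 6)) ⊕ Fin 8 → ℕ :=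
  Sum.elim decomposableDeg fun _ => 1

theorem isHomogeneous_apolarRel (c : Coeffs) (j) :
    (apolarRel c j).IsHomogeneous (apolarDeg j) := by
  rcases j with j | k <;> simp only [apolarRel, apolarDeg, Sum.elim_inl, Sum.elim_inr]
  · exact isHomogeneous_decomposableRel j
  · exact isHomogeneous_linForm _

theorem isHomFun_coeff_apolarRel (j) (l : Fin 6 × Fin 6 →₀ ℕ) :
    IsHomFun (Sum.elim (fun _ => 0) (fun _ => 1) j) (fun c => coeff l (apolarRel c j)) := by
  rcases j with j | k <;> simp only [apolarRel, Sum.elim_inl, Sum.elim_inr]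
  · exact IsHomFun.const _
  · refine isHomFun_coeff_linForm (fun q => ?_) l
    by_cases h : q.1 < q.2
    · simpa [h] using IsHomFun.coord _
    · simpa [h] using IsHomFun.zero 1

theorem eval_contract_linForm (c : Coeffs) (k : Fin 8) (w : Fin 6 × Fin 6 → ℂ) :
    eval w (linForm fun q => if h : q.1 < q.2 then c (⟨q, h⟩, k) else 0) =
      contract w (coeffCol c k) := by
  rw [eval_linForm, contract_apply]
  have h := sum_PIdx fun q => (if h : q.1 < q.2 then c (⟨q, h⟩, k) else 0) * w q
  have h2 : ∑ p : PIdx, w p.1 * coeffCol c k p =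
      ∑ p : PIdx, (if h : p.1.1 < p.1.2 then c (⟨p.1, h⟩, k) else 0) * w p.1 :=
    Finset.sum_congr rfl fun p _ => by rw [dif_pos p.2, mul_comm]; rfl
  rw [h2, h, Fintype.sum_prod_type]
  refine Finset.sum_congr rfl fun i _ => Finset.sum_congr rfl fun j _ => ?_
  split_ifs
  · rfl
  · simp

theorem forall_eval_apolarRel_iff {c : Coeffs} {w : Fin 6 × Fin 6 → ℂ} :
    (∀ j, eval w (apolarRel c j) = 0) ↔
      IsDecomposable w ∧ ∀ k, contract w (coeffCol c k) = 0 := by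
  rw [Sum.forall, ← forall_eval_decomposableRel_iff]
  simp only [apolarRel, Sum.elim_inl, Sum.elim_inr, eval_contract_linForm]

/-- Elimination is applied to the Plücker relations, the apolarity equations and the fixed linear
form H. Only the apolarity equations involve c, and they do so linearly. -/
theorem exists_polynomials_iff_avoids (H : Fin 6 × Fin 6 → ℂ) :
    ∃ S : Set (MvPolynomial (PIdx × Fin 8) ℂ), (∀ F ∈ S, ∃ n, F.IsHomogeneous n) ∧
      ∀ c, (∃ F ∈ S, eval c F ≠ 0) ↔ ∀ w, IsDecomposable w →
        (∀ k, contract w (coeffCol c k) = 0) → ∑ q, H q * w q = 0 → w = 0 := by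
  obtain ⟨S, hS, h⟩ := exists_polynomials_iff_only_zero
    (fun j (c : Coeffs) => Sum.elim (apolarRel c) (fun _ : Unit => linForm H) j)
    (Sum.elim apolarDeg fun _ => 1) (Sum.elim (Sum.elim (fun _ => 0) fun _ => 1) fun _ => 0)
    (by
      rintro (j | u) c <;> simp only [Sum.elim_inl, Sum.elim_inr]
      · exact isHomogeneous_apolarRel c j
      · exact isHomogeneous_linForm _)
    (by
      rintro (j | u) l <;> simp only [Sum.elim_inl, Sum.elim_inr]
      · exact isHomFun_coeff_apolarRel j l
      · exact IsHomFun.const _)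
  refine ⟨S, hS, fun c => (h c).trans (forall_congr' fun w => ?_)⟩
  rw [Sum.forall]
  simp only [Sum.elim_inl, Sum.elim_inr, forall_eval_apolarRel_iff, eval_linForm, forall_const]
  tauto

theorem exists_polynomials_iff_injective :
    ∃ S : Set (MvPolynomial (PIdx × Fin 8) ℂ), (∀ F ∈ S, ∃ n, F.IsHomogeneous n) ∧
      ∀ c, (∃ F ∈ S, eval c F ≠ 0) ↔ Function.Injective (coeffMap c) := by
  obtain ⟨S, hS, h⟩ := exists_polynomials_iff_only_zero
    (fun (p : PIdx) (c : Coeffs) => linForm fun k => c (p, k)) (fun _ => 1) (fun _ => 1)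
    (fun _ _ => isHomogeneous_linForm _)
    (fun p k => isHomFun_coeff_linForm (fun i => IsHomFun.coord _) k)
  refine ⟨S, hS, fun c => (h c).trans ?_⟩
  rw [← LinearMap.ker_eq_bot, LinearMap.ker_eq_bot']
  refine forall_congr' fun w => imp_congr ?_ Iff.rfl
  rw [funext_iff]
  refine forall_congr' fun p => ?_
  rw [eval_linForm, coeffMap_apply, Finset.sum_apply]
  simp [coeffCol, mul_comm]

/-- The two genericity conditions are the nonvanishing of one of a set of forms. -/
theorem exists_polynomials_iff_generic :
    ∃ S : Set (MvPolynomial (PIdx × Fin 8) ℂ), (∀ F ∈ S, ∃ n, F.IsHomogeneous n) ∧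
      ∀ c, (∃ F ∈ S, eval c F ≠ 0) ↔
        Function.Injective (coeffMap c) ∧ HasAvoidingHyperplane c := by
  obtain ⟨S₁, hS₁, h₁⟩ := exists_polynomials_iff_injective
  choose S₂ hS₂ h₂ using exists_polynomials_iff_avoids
  -- Products encode the conjunction; letting H vary encodes the existence of a hyperplane.
  refine ⟨{F | ∃ F₁ ∈ S₁, ∃ H, ∃ F₂ ∈ S₂ H, F = F₁ * F₂}, ?_, fun c => ?_⟩
  · rintro _ ⟨F₁, hF₁, H, F₂, hF₂, rfl⟩
    obtain ⟨n₁, hn₁⟩ := hS₁ F₁ hF₁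
    obtain ⟨n₂, hn₂⟩ := hS₂ H F₂ hF₂
    exact ⟨_, hn₁.mul hn₂⟩
  · constructor
    · rintro ⟨_, ⟨F₁, hF₁, H, F₂, hF₂, rfl⟩, h⟩
      rw [map_mul] at h
      exact ⟨(h₁ c).1 ⟨F₁, hF₁, left_ne_zero_of_mul h⟩, H,
        (h₂ H c).1 ⟨F₂, hF₂, right_ne_zero_of_mul h⟩⟩
    · rintro ⟨hinj, H, hH⟩
      obtain ⟨F₁, hF₁, h1⟩ := (h₁ c).2 hinj
      obtain ⟨F₂, hF₂, h2⟩ := (h₂ H c).2 hH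
      exact ⟨_, ⟨F₁, hF₁, H, F₂, hF₂, rfl⟩, by rw [map_mul]; exact mul_ne_zero h1 h2⟩

end Systems

/-! ### Four-dimensional subspaces as radicals of decomposable forms. -/

/-- The matrix of the exterior product of two linear forms. -/
def wedgeForms (ξ η : (Fin 6 → ℂ) →ₗ[ℂ] ℂ) (q : Fin 6 × Fin 6) : ℂ :=
  ξ (Pi.single q.1 1) * η (Pi.single q.2 1) - ξ (Pi.single q.2 1) * η (Pi.single q.1 1)

theorem isDecomposable_wedgeForms (ξ η : (Fin 6 → ℂ) →ₗ[ℂ] ℂ) :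
    IsDecomposable (wedgeForms ξ η) :=
  ⟨fun i => by simp only [wedgeForms]; ring, fun i j => by simp only [wedgeForms]; ring,
    fun i j k l => by simp only [wedgeForms]; ring⟩

theorem bil_wedgeForms (ξ η : (Fin 6 → ℂ) →ₗ[ℂ] ℂ) (x y : Fin 6 → ℂ) :
    bil (wedgeForms ξ η) x y = ξ x * η y - ξ y * η x := by
  have hexp : ∀ (ξ : (Fin 6 → ℂ) →ₗ[ℂ] ℂ) (z : Fin 6 → ℂ),
      ξ z = ∑ i, z i * ξ (Pi.single i 1) := by
    intro ξ z
    rw [LinearMap.pi_apply_eq_sum_univ ξ z]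
    refine Finset.sum_congr rfl fun i _ => ?_
    rw [smul_eq_mul]
    congr 2
    ext j
    simp [Pi.single_apply, eq_comm]
  rw [bil_apply, hexp ξ x, hexp η y, hexp ξ y, hexp η x, Finset.sum_mul_sum, Finset.sum_mul_sum,
    Finset.sum_comm (f := fun i j => y i * ξ (Pi.single i 1) * (x j * η (Pi.single j 1))),
    ← Finset.sum_sub_distrib]
  refine Finset.sum_congr rfl fun i _ => ?_
  rw [← Finset.sum_sub_distrib]
  refine Finset.sum_congr rfl fun j _ => ?_
  simp only [wedgeForms]
  ring

/-- Two linear forms cut out p, and the radical of their exterior product is exactly p. So p is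
recovered from w. -/
theorem exists_decomposable_of_finrank_eq_four {p : Submodule ℂ (Fin 6 → ℂ)}
    (hp : Module.finrank ℂ p = 4) : ∃ w, IsDecomposable w ∧ ∀ x, x ∈ p ↔ ∀ y, bil w x y = 0 := by
  have hq : Module.finrank ℂ ((Fin 6 → ℂ) ⧸ p) = Module.finrank ℂ (Fin 2 → ℂ) := by
    have := p.finrank_quotient_add_finrank
    rw [Module.finrank_fin_fun] at this ⊢
    omega
  let φ := LinearEquiv.ofFinrankEq _ _ hq
  let L : (Fin 6 → ℂ) →ₗ[ℂ] (Fin 2 → ℂ) := φ.toLinearMap ∘ₗ p.mkQ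
  have hLp : ∀ x, x ∈ p ↔ L x = 0 := fun x => by simp [L]
  have hLs : Function.Surjective L := φ.surjective.comp p.mkQ_surjective
  have hw : ∀ x y, bil (wedgeForms (LinearMap.proj 0 ∘ₗ L) (LinearMap.proj 1 ∘ₗ L)) x y =
      L x 0 * L y 1 - L y 0 * L x 1 := fun x y => bil_wedgeForms _ _ x y
  refine ⟨_, isDecomposable_wedgeForms (LinearMap.proj 0 ∘ₗ L) (LinearMap.proj 1 ∘ₗ L),
    fun x => ?_⟩
  rw [hLp]
  constructor
  · intro hx y
    simp [hw, hx]
  · intro hx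
    obtain ⟨y, hy⟩ := hLs ![0, 1]
    obtain ⟨z, hz⟩ := hLs ![1, 0]
    have h1 := hx y
    have h2 := hx z
    rw [hw] at h1 h2
    funext m
    fin_cases m
    · simpa [hy] using h1
    · simpa [hz] using h2

theorem IsDecomposable.smul {w : Fin 6 × Fin 6 → ℂ} (hw : IsDecomposable w) (r : ℂ) :
    IsDecomposable (r • w) := by
  refine ⟨fun i => by simp [hw.diag], fun i j => ?_, fun i j k l => ?_⟩
  · simp [hw.swap i j]
  · simp only [Pi.smul_apply, smul_eq_mul]
    linear_combination r ^ 2 * hw.plucker i j k l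

theorem bil_smul (r : ℂ) (w : Fin 6 × Fin 6 → ℂ) (x y : Fin 6 → ℂ) :
    bil (r • w) x y = r * bil w x y := by
  simp only [bil_apply, Pi.smul_apply, smul_eq_mul, Finset.mul_sum, mul_assoc]

theorem contract_smul (r : ℂ) (w : Fin 6 × Fin 6 → ℂ) (y : PIdx → ℂ) :
    contract (r • w) y = r * contract w y := by
  simp only [contract_apply, Pi.smul_apply, smul_eq_mul, Finset.mul_sum, mul_assoc]

/-- A nonzero vector s a + t b of the line that lies in p is in the radical of w; pairing it with a
and b kills w(a, b). -/
theorem contract_eq_zero_of_mem_schubertCycle {w : Fin 6 × Fin 6 → ℂ} (hw : IsDecomposable w)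
    {p : Submodule ℂ (Fin 6 → ℂ)} (hp : ∀ x, x ∈ p ↔ ∀ y, bil w x y = 0) {u : PIdx → ℂ}
    (hu : u ≠ 0) (h : Projectivization.mk ℂ u hu ∈ schubertCycle p) : contract w u = 0 := by
  obtain ⟨L, ⟨a, b, hab, rfl, hmk⟩, hLp⟩ := h
  obtain ⟨x, hx, hx0⟩ := Submodule.exists_mem_ne_zero_of_ne_bot hLp
  obtain ⟨hxL, hxp⟩ := Submodule.mem_inf.1 hx
  obtain ⟨s, t, rfl⟩ := Submodule.mem_span_pair.1 hxL
  rw [hp] at hxp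
  have h0 : bil w a b = 0 := by
    have h1 := hxp a
    have h2 := hxp b
    simp only [map_add, map_smul, LinearMap.add_apply, LinearMap.smul_apply, smul_eq_mul,
      bil_self hw.diag hw.swap, mul_zero, zero_add, add_zero] at h1 h2
    rcases mul_eq_zero.1 h2 with h | h
    · rcases mul_eq_zero.1 h1 with h' | h'
      · simp [h, h'] at hx0
      · rw [bil_swap hw.diag hw.swap, h', neg_zero]
    · exact h
  obtain ⟨r, hr⟩ := (Projectivization.mk_eq_mk_iff' ℂ _ _ hu hab).1 hmk
  rw [← hr, map_smul, ← wedge_apply, contract_wedge hw.diag hw.swap, h0, smul_zero]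

/-- The Schubert cycles containing the curve correspond to the decomposable forms apolar to it. -/
theorem finite_W1 {f : ℙ ℂ Coeffs} (hf : HasAvoidingHyperplane f.rep) :
    (W1 (imageCurve f)).Finite := by
  obtain ⟨H, hH⟩ := hf
  have hfin := finite_zeros_off_hyperplane (apolarRel f.rep)
    apolarDeg (isHomogeneous_apolarRel _)
    (linForm H) (isHomogeneous_linForm H)
    (by
      intro w hw hwH
      rw [forall_eval_apolarRel_iff] at hw
      exact hH w hw.1 hw.2 (by rwa [eval_linForm] at hwH))
  -- Each p is the radical of an apolar decomposable form, which can be scaled to take the value 1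
  -- on H since it avoids that hyperplane.
  refine (hfin.image fun w => LinearMap.ker (bil w)).subset ?_
  rintro p ⟨hp4, hp⟩
  obtain ⟨w, hw, hwp⟩ := exists_decomposable_of_finrank_eq_four hp4
  -- The contraction with the values of f is a binary septic; it vanishes at every point, so all its
  -- coefficients vanish.
  have hcon : ∀ k, contract w (coeffCol f.rep k) = 0 := by
    refine congrFun (eq_zero_of_sum_veronese_eq_zero (d := 7)
      (x := fun k => contract w (coeffCol f.rep k)) fun v hv => ?_)
    have hsum : ∀ v, ∑ k, contract w (coeffCol f.rep k) * veronese 7 v k =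
        contract w (evalVec f.rep v) := fun v => by
      rw [evalVec_eq_coeffMap, coeffMap_apply, map_sum]
      exact Finset.sum_congr rfl fun k _ => by rw [map_smul, smul_eq_mul, mul_comm]
    obtain ⟨r, hr, hrep⟩ := rep_mk_eq_smul hv
    have h0 : contract w (evalVec f.rep (Projectivization.mk ℂ v hv).rep) = 0 := by
      by_cases h : evalVec f.rep (Projectivization.mk ℂ v hv).rep = 0
      · rw [h, map_zero]
      · exact contract_eq_zero_of_mem_schubertCycle hw hwp h (hp ⟨_, h, rfl⟩)
    rw [hsum]
    rw [hrep, evalVec_eq_coeffMap, veronese_smul, map_smul, map_smul, smul_eq_mul] at h0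
    rw [evalVec_eq_coeffMap]
    exact (mul_eq_zero.1 h0).resolve_left (pow_ne_zero _ hr)
  have hw0 : w ≠ 0 := by
    rintro rfl
    have : p = ⊤ := by
      rw [eq_top_iff]
      exact fun x _ => (hwp x).2 fun y => by simp [bil_apply]
    rw [this, finrank_top, Module.finrank_fin_fun] at hp4
    omega
  have hHw : ∑ q, H q * w q ≠ 0 := fun h => hw0 (hH w hw hcon h)
  refine ⟨(∑ q, H q * w q)⁻¹ • w, ⟨forall_eval_apolarRel_iff.2 ⟨hw.smul _, fun k => ?_⟩, ?_⟩, ?_⟩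
  · rw [contract_smul, hcon, mul_zero]
  · rw [eval_linForm]
    simp only [Pi.smul_apply, smul_eq_mul, mul_left_comm (H _), ← Finset.mul_sum]
    exact inv_mul_cancel₀ hHw
  · ext x
    rw [hwp, LinearMap.mem_ker, LinearMap.ext_iff]
    refine forall_congr' fun y => ?_
    rw [bil_smul, LinearMap.zero_apply, mul_eq_zero, or_iff_right (inv_ne_zero hHw)]

/-! ### Separation of points by Veronese vectors -/

/-- The bracket of two vectors of the plane; it vanishes when they define the same point of `ℙ¹`. -/
def bracket (u v : Fin 2 → ℂ) : ℂ := u 0 * v 1 - u 1 * v 0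

theorem ne_zero_of_bracket_left {u v : Fin 2 → ℂ} (h : bracket u v ≠ 0) : u ≠ 0 := by
  rintro rfl
  simp [bracket] at h

theorem ne_zero_of_bracket_right {u v : Fin 2 → ℂ} (h : bracket u v ≠ 0) : v ≠ 0 := by
  rintro rfl
  simp [bracket] at h

theorem exists_smul_eq_of_bracket_eq_zero {u v : Fin 2 → ℂ} (hv : v ≠ 0) (h : bracket u v = 0) :
    ∃ r : ℂ, r • v = u := by
  rw [bracket] at h
  by_cases h0 : v 0 = 0
  · have h1 : v 1 ≠ 0 := fun h1 => hv (by funext i; fin_cases i <;> assumption)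
    refine ⟨u 1 / v 1, ?_⟩
    have hu : u 0 = 0 := by
      rw [h0, mul_zero, sub_zero] at h
      exact (mul_eq_zero.1 h).resolve_right h1
    funext i
    fin_cases i
    · simp [h0, hu]
    · simp [div_mul_cancel₀ _ h1]
  · refine ⟨u 0 / v 0, ?_⟩
    funext i
    fin_cases i
    · simp [div_mul_cancel₀ _ h0]
    · simp only [Fin.mk_one, Pi.smul_apply, smul_eq_mul]
      field_simp
      linear_combination h

theorem bracket_eq_zero_of_veronese_three {s t : Fin 2 → ℂ} (hs : s ≠ 0) {r : ℂ}
    (h : veronese 3 s = r • veronese 3 t) : bracket s t = 0 := by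
  have e : ∀ i : Fin 4, veronese 3 s i = r * veronese 3 t i := fun i => congrFun h i
  have e0 := e 0
  have e1 := e 1
  have e2 := e 2
  have e3 := e 3
  simp [veronese] at e0 e1 e2 e3
  by_cases h0 : s 0 = 0
  · have h1 : s 1 ≠ 0 := fun h1 => hs (by funext i; fin_cases i <;> assumption)
    refine (mul_eq_zero.1 (?_ : s 1 ^ 2 * bracket s t = 0)).resolve_left (pow_ne_zero _ h1)
    rw [bracket]
    linear_combination t 1 * e2 - t 0 * e3
  · refine (mul_eq_zero.1 (?_ : s 0 ^ 2 * bracket s t = 0)).resolve_left (pow_ne_zero _ h0)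
    rw [bracket]
    linear_combination t 1 * e0 - t 0 * e1

/-- The septics X₀⁵ · [X, t][X, t'] and X₁⁵ · [X, t][X, t'] vanish at t and t', hence at s. One of
the two has a nonzero first factor at s. Taking t = t' separates two points. -/
theorem bracket_mul_bracket_eq_zero_of_veronese_seven {s t t' : Fin 2 → ℂ} (hs : s ≠ 0) {a b : ℂ}
    (h : veronese 7 s = a • veronese 7 t + b • veronese 7 t') :
    bracket s t * bracket s t' = 0 := by
  have e : ∀ i : Fin 8, veronese 7 s i = a * veronese 7 t i + b * veronese 7 t' i :=
    fun i => congrFun h i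
  have e0 := e 0
  have e1 := e 1
  have e2 := e 2
  have e5 := e 5
  have e6 := e 6
  have e7 := e 7
  simp [veronese] at e0 e1 e2 e5 e6 e7
  by_cases h0 : s 0 = 0
  · have h1 : s 1 ≠ 0 := fun h1 => hs (by funext i; fin_cases i <;> assumption)
    refine (mul_eq_zero.1 (?_ : s 1 ^ 5 * (bracket s t * bracket s t') = 0)).resolve_left
      (pow_ne_zero _ h1)
    simp only [bracket]
    linear_combination t 1 * t' 1 * e5 - (t 1 * t' 0 + t 0 * t' 1) * e6 + t 0 * t' 0 * e7
  · refine (mul_eq_zero.1 (?_ : s 0 ^ 5 * (bracket s t * bracket s t') = 0)).resolve_left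
      (pow_ne_zero _ h0)
    simp only [bracket]
    linear_combination t 1 * t' 1 * e0 - (t 1 * t' 0 + t 0 * t' 1) * e1 + t 0 * t' 0 * e2

/-! ### Embeddings -/

/-- The partial derivatives of the Veronese vector of degree 7. -/
def partialVeronese (j : Fin 2) (v : Fin 2 → ℂ) : Fin 8 → ℂ := fun k =>
  if j = 0 then ((7 - (k : ℕ) : ℕ) : ℂ) * v 0 ^ (7 - (k : ℕ) - 1) * v 1 ^ (k : ℕ)
  else ((k : ℕ) : ℂ) * v 0 ^ (7 - (k : ℕ)) * v 1 ^ ((k : ℕ) - 1)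

theorem partialVec_eq_coeffMap (c : Coeffs) (j : Fin 2) (v : Fin 2 → ℂ) :
    partialVec c j v = coeffMap c (partialVeronese j v) := by
  funext p
  simp only [partialVec, form, map_sum, coeffMap_apply, Finset.sum_apply, Pi.smul_apply,
    smul_eq_mul, coeffCol]
  refine Finset.sum_congr rfl fun k _ => ?_
  fin_cases j
  · simp [MvPolynomial.pderiv_X, partialVeronese]
    ring
  · simp [MvPolynomial.pderiv_X, partialVeronese]
    ring

theorem linearIndependent_partialVeronese {v : Fin 2 → ℂ} (hv : v ≠ 0) :
    LinearIndependent ℂ ![partialVeronese 0 v, partialVeronese 1 v] := by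
  rw [LinearIndependent.pair_iff]
  intro a b h
  have e : ∀ k, a * partialVeronese 0 v k + b * partialVeronese 1 v k = 0 := congrFun h
  have e0 := e 0
  have e1 := e 1
  have e6 := e 6
  have e7 := e 7
  simp [partialVeronese] at e0 e1 e6 e7
  by_cases h0 : v 0 = 0
  · have h1 : v 1 ≠ 0 := fun h1 => hv (by funext i; fin_cases i <;> assumption)
    simp [h0, h1] at e6 e7
    exact ⟨e6, e7⟩
  · have ha : a = 0 := by simpa [h0] using e0
    simp [ha, h0] at e1
    exact ⟨ha, e1⟩

theorem isEmbedding7_of_injective {f : ℙ ℂ Coeffs} (hf : Function.Injective (coeffMap f.rep)) :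
    IsEmbedding7 f := by
  refine ⟨?_, fun v hv => ?_⟩
  · rintro x x' y ⟨h, rfl⟩ ⟨h', hy⟩
    obtain ⟨r, hr⟩ := (Projectivization.mk_eq_mk_iff' ℂ _ _ h h').1 hy
    rw [evalVec_eq_coeffMap, evalVec_eq_coeffMap, ← map_smul] at hr
    have hb := bracket_mul_bracket_eq_zero_of_veronese_seven (t := x'.rep) (t' := x'.rep)
      (a := r) (b := 0) x.rep_nonzero ((hf hr).symm.trans (by simp))
    have hb' : bracket x.rep x'.rep = 0 := by simpa only [mul_self_eq_zero] using hb
    obtain ⟨s, hs⟩ := exists_smul_eq_of_bracket_eq_zero x'.rep_nonzero hb'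
    rw [← x.mk_rep, ← x'.mk_rep, Projectivization.mk_eq_mk_iff']
    exact ⟨s, hs⟩
  · rw [partialVec_eq_coeffMap, partialVec_eq_coeffMap]
    have := (linearIndependent_partialVeronese hv).map' (coeffMap f.rep)
      (LinearMap.ker_eq_bot.2 hf)
    have heq : coeffMap f.rep ∘ ![partialVeronese 0 v, partialVeronese 1 v] =
        ![coeffMap f.rep (partialVeronese 0 v), coeffMap f.rep (partialVeronese 1 v)] := by
      funext i
      fin_cases i <;> rfl
    rwa [heq] at this

/-! ### Projections from general 3-secant planes give members of the family -/

theorem coeffMap_smul (r : ℂ) (c : Coeffs) : coeffMap (r • c) = r • coeffMap c := by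
  refine LinearMap.ext fun x => ?_
  simp only [coeffMap_apply, LinearMap.smul_apply, Finset.smul_sum]
  exact Finset.sum_congr rfl fun k _ => smul_comm (x k) r (coeffCol c k)

theorem mem_G15_of_eq_wedge {z : P14} {a b : Fin 6 → ℂ} (h : z.rep = wedge a b) : z ∈ G15 := by
  have h0 : pluckerVec a b ≠ 0 := by
    rw [← wedge_apply, ← h]
    exact z.rep_nonzero
  refine ⟨_, a, b, h0, rfl, ?_⟩
  conv_lhs => rw [← z.mk_rep]
  simp only [h, wedge_apply]

/-- A point of the join of the rulings over `s` and `t`. -/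
def secantVec (s t : Fin 2 → ℂ) (α β γ δ : ℂ) : C9 :=
  (α • cubicPt s + β • quarticPt s) + (γ • cubicPt t + δ • quarticPt t)

theorem smul_cubicPt_add_smul_quarticPt_inl (s : Fin 2 → ℂ) (α β : ℂ) :
    (fun i => (α • cubicPt s + β • quarticPt s) (Sum.inl i)) = α • veronese 3 s := by
  funext i
  simp [cubicPt, quarticPt]

theorem smul_cubicPt_add_smul_quarticPt_ne_zero {s : Fin 2 → ℂ} (hs : s ≠ 0) {α β : ℂ}
    (hα : α ≠ 0) : α • cubicPt s + β • quarticPt s ≠ 0 := by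
  intro h
  have := smul_cubicPt_add_smul_quarticPt_inl s α β
  rw [h] at this
  exact smul_ne_zero hα (veronese_ne_zero 3 hs) this.symm

theorem subset_zariskiClosure {ι : Type} (X : Set (ℙ ℂ (ι → ℂ))) : X ⊆ zariskiClosure X :=
  fun _ hx _ _ hXZ => hXZ hx

theorem secantVec_mem {s t : Fin 2 → ℂ} (hst : bracket s t ≠ 0) {α β γ δ : ℂ} (hα : α ≠ 0)
    (hγ : γ ≠ 0) {a : ℙ ℂ C9} (ha : a.submodule = ℂ ∙ secantVec s t α β γ δ) :
    ∃ x ∈ S34, ∃ y ∈ S34, x ≠ y ∧ a.submodule ≤ x.submodule ⊔ y.submodule := by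
  have hs := ne_zero_of_bracket_left hst
  have ht := ne_zero_of_bracket_right hst
  have hx := smul_cubicPt_add_smul_quarticPt_ne_zero hs (β := β) hα
  have hy := smul_cubicPt_add_smul_quarticPt_ne_zero ht (β := δ) hγ
  have hmem : ∀ (v : Fin 2 → ℂ) (a b : ℂ), a • cubicPt v + b • quarticPt v ∈ ruling v :=
    fun v a b => Submodule.mem_span_pair.2 ⟨a, b, rfl⟩
  refine ⟨Projectivization.mk ℂ _ hx, ⟨s, hs, ?_⟩, Projectivization.mk ℂ _ hy, ⟨t, ht, ?_⟩, ?_, ?_⟩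
  · rw [Projectivization.submodule_mk, Submodule.span_singleton_le_iff_mem]
    exact hmem _ _ _
  · rw [Projectivization.submodule_mk, Submodule.span_singleton_le_iff_mem]
    exact hmem _ _ _
  · intro h
    obtain ⟨r, hr⟩ := (Projectivization.mk_eq_mk_iff' ℂ _ _ hx hy).1 h
    refine hst (bracket_eq_zero_of_veronese_three hs (r := α⁻¹ * (r * γ)) ?_)
    have h1 := smul_cubicPt_add_smul_quarticPt_inl s α β
    have h2 := smul_cubicPt_add_smul_quarticPt_inl t γ δ
    rw [← hr] at h1
    have h3 : α • veronese 3 s = r • γ • veronese 3 t := by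
      rw [← h1, ← h2]
      rfl
    rw [mul_smul, mul_smul, ← h3, smul_smul, inv_mul_cancel₀ hα, one_smul]
  · rw [ha, Projectivization.submodule_mk, Projectivization.submodule_mk,
      Submodule.span_singleton_le_iff_mem]
    exact Submodule.add_mem_sup (Submodule.mem_span_singleton_self _)
      (Submodule.mem_span_singleton_self _)

/-- The i-th bisecant joins the values at `s i` and `t i`. Injectivity of `coeffMap` carries the
independence of points on the rational normal curve over to Γ. It makes f an embedding, separates
the bisecants and keeps the center off the scroll. -/
theorem mk_projCoeffs_mem_familyU {M : C9 →ₗ[ℂ] (Fin 6 → ℂ)} (hM : Function.Surjective M)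
    {s t : Fin 3 → Fin 2 → ℂ} {α β γ δ : Fin 3 → ℂ}
    (hli : LinearIndependent ℂ fun i => secantVec (s i) (t i) (α i) (β i) (γ i) (δ i))
    (hker : LinearMap.ker M = Submodule.span ℂ
      (Set.range fun i => secantVec (s i) (t i) (α i) (β i) (γ i) (δ i)))
    (hst : ∀ i j, bracket (s i) (t j) ≠ 0) (hss : ∀ i j, i ≠ j → bracket (s i) (s j) ≠ 0)
    (hα : ∀ i, α i ≠ 0) (hγ : ∀ i, γ i ≠ 0)
    (hinj : Function.Injective (coeffMap (projCoeffs M))) (h0 : projCoeffs M ≠ 0) :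
    Projectivization.mk ℂ (projCoeffs M) h0 ∈ familyU := by
  obtain ⟨r, hr, hrep⟩ := rep_mk_eq_smul h0
  set f := Projectivization.mk ℂ (projCoeffs M) h0 with hf
  have hfinj : Function.Injective (coeffMap f.rep) := by
    rw [hrep, coeffMap_smul]
    exact (smul_right_injective _ hr).comp hinj
  have hval : ∀ v, coeffMap f.rep (veronese 7 v) = r • wedge (M (cubicPt v)) (M (quarticPt v)) :=
    fun v => by rw [← evalVec_projCoeffs, evalVec_eq_coeffMap, hrep, coeffMap_smul]; rfl
  have hval0 : ∀ v, v ≠ 0 → coeffMap f.rep (veronese 7 v) ≠ 0 := fun v hv =>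
    coeffMap_veronese_ne_zero hfinj hv
  have hs0 : ∀ i, s i ≠ 0 := fun i => ne_zero_of_bracket_left (hst i i)
  have ht0 : ∀ i, t i ≠ 0 := fun i => ne_zero_of_bracket_right (hst i i)
  let P : ∀ v : Fin 2 → ℂ, v ≠ 0 → P14 := fun v hv => Projectivization.mk ℂ _ (hval0 v hv)
  have hP : ∀ v hv, P v hv ∈ imageCurve f := fun v hv =>
    mem_imageCurve_iff.2 ⟨v, hv, hval0 v hv, rfl⟩
  have hPsub : ∀ v hv, (P v hv).submodule = ℂ ∙ coeffMap f.rep (veronese 7 v) := fun v hv =>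
    Projectivization.submodule_mk _ _
  have hsup : ∀ u hu v hv (z : PIdx → ℂ), z ∈ (P u hu).submodule ⊔ (P v hv).submodule →
      ∃ a b : ℂ, z = a • coeffMap f.rep (veronese 7 u) + b • coeffMap f.rep (veronese 7 v) := by
    intro u hu v hv z hz
    rw [hPsub u hu, hPsub v hv, Submodule.mem_sup] at hz
    obtain ⟨x, hx, y, hy, rfl⟩ := hz
    obtain ⟨a, rfl⟩ := Submodule.mem_span_singleton.1 hx
    obtain ⟨b, rfl⟩ := Submodule.mem_span_singleton.1 hy
    exact ⟨a, b, rfl⟩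
  have hne : ∀ i, secantVec (s i) (t i) (α i) (β i) (γ i) (δ i) ≠ 0 := fun i => hli.ne_zero i
  have hsum : (⨆ i, (Projectivization.mk ℂ _ (hne i)).submodule : Submodule ℂ C9) =
      LinearMap.ker M := by
    simp only [Projectivization.submodule_mk]
    rw [hker, Submodule.span_range_eq_iSup]
  refine ⟨fun v hv => ?_, isEmbedding7_of_injective hfinj,
    ⟨fun i => (P (s i) (hs0 i)).submodule ⊔ (P (t i) (ht0 i)).submodule, ?_, fun i =>
      ⟨⟨P _ (hs0 i), hP _ (hs0 i), P _ (ht0 i), hP _ (ht0 i), ?_, rfl⟩, fun z hz => ?_⟩⟩,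
    fun i => Projectivization.mk ℂ _ (hne i), M, fun i => ?_, ?_, hM, hsum.symm, ?_, ?_⟩
  · have h : evalVec f.rep v ≠ 0 := by
      rw [evalVec_eq_coeffMap]
      exact hval0 v hv
    obtain ⟨q, hq, hqrep⟩ := rep_mk_eq_smul h
    refine ⟨h, mem_G15_of_eq_wedge (a := (q * r) • M (cubicPt v)) (b := M (quarticPt v)) ?_⟩
    rw [hqrep, evalVec_eq_coeffMap, hval, map_smul, LinearMap.smul_apply, smul_smul]
  · intro i j hij
    dsimp only at hij
    by_contra hne
    have hmem : coeffMap f.rep (veronese 7 (s i)) ∈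
        (P (s j) (hs0 j)).submodule ⊔ (P (t j) (ht0 j)).submodule := by
      rw [← hij, hPsub _ (hs0 i)]
      exact Submodule.mem_sup_left (Submodule.mem_span_singleton_self _)
    obtain ⟨a, b, hab⟩ := hsup _ (hs0 j) _ (ht0 j) _ hmem
    -- If two bisecants coincided, three distinct points of the rational normal curve would be
    -- collinear.
    rw [← map_smul, ← map_smul, ← map_add] at hab
    exact mul_ne_zero (hss i j hne) (hst i j)
      (bracket_mul_bracket_eq_zero_of_veronese_seven (hs0 i) (hfinj hab))
  · intro h
    obtain ⟨a, ha⟩ := (Projectivization.mk_eq_mk_iff' ℂ _ _ _ _).1 h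
    rw [← map_smul] at ha
    have := bracket_mul_bracket_eq_zero_of_veronese_seven (t := t i) (t' := t i)
      (a := a) (b := 0) (hs0 i) ((hfinj ha).symm.trans (by simp))
    exact hst i i (mul_self_eq_zero.1 this)
  · have hzr : z.rep ∈ (P (s i) (hs0 i)).submodule ⊔ (P (t i) (ht0 i)).submodule := by
      apply hz
      rw [Projectivization.submodule_eq]
      exact Submodule.mem_span_singleton_self _
    obtain ⟨a, b, hab⟩ := hsup _ (hs0 i) _ (ht0 i) _ hzr
    rw [hval, hval] at hab
    have hMa : M (secantVec (s i) (t i) (α i) (β i) (γ i) (δ i)) = 0 := by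
      rw [← LinearMap.mem_ker, hker]
      exact Submodule.subset_span ⟨i, rfl⟩
    rw [secantVec, map_add, map_add, map_add, map_smul, map_smul, map_smul, map_smul] at hMa
    set A := M (cubicPt (s i))
    set B := M (quarticPt (s i))
    set A' := M (cubicPt (t i))
    set B' := M (quarticPt (t i))
    -- The two projected rulings share the vector α A + β B = -(γ A' + δ B'). Both Plücker vectors
    -- are multiples of wedges with it, so every combination of them is decomposable.
    have h1 : wedge (α i • A + β i • B) B = α i • wedge A B := by
      simp [wedge_self]
    have h2 : wedge (α i • A + β i • B) B' = -(γ i • wedge A' B') := by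
      rw [eq_neg_of_add_eq_zero_left hMa]
      simp [wedge_self]
    refine mem_G15_of_eq_wedge (a := α i • A + β i • B)
      (b := (a * r * (α i)⁻¹) • B - (b * r * (γ i)⁻¹) • B') ?_
    rw [hab, map_sub, map_smul, map_smul, h1, h2, smul_neg, sub_neg_eq_add, smul_smul, smul_smul,
      smul_smul, smul_smul, inv_mul_cancel_right₀ (hα i), inv_mul_cancel_right₀ (hγ i)]
  · exact subset_zariskiClosure _
      (secantVec_mem (hst i i) (hα i) (hγ i) (Projectivization.submodule_mk _ _))
  · rw [hsum, hker, finrank_span_eq_card hli, Fintype.card_fin]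
  · rintro x ⟨v, hv, hxv⟩ hxM
    have hxr : x.rep ∈ x.submodule := by
      rw [Projectivization.submodule_eq]
      exact Submodule.mem_span_singleton_self _
    obtain ⟨a, b, hab⟩ := Submodule.mem_span_pair.1 (hxv hxr)
    have hM0 : M x.rep = 0 := hxM hxr
    -- M is injective on each ruling because the Plücker vector of its image is nonzero, so no
    -- scroll point lies in the center.
    have hw0 : wedge (M (cubicPt v)) (M (quarticPt v)) ≠ 0 := fun h =>
      hval0 v hv (by rw [hval, h, smul_zero])
    rw [← hab, map_add, map_smul, map_smul] at hM0
    have h1 : a • wedge (M (cubicPt v)) (M (quarticPt v)) = 0 := by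
      have : wedge (a • M (cubicPt v) + b • M (quarticPt v)) (M (quarticPt v)) = 0 := by
        rw [hM0, map_zero, LinearMap.zero_apply]
      simpa [wedge_self] using this
    have h2 : b • wedge (M (cubicPt v)) (M (quarticPt v)) = 0 := by
      have : wedge (M (cubicPt v)) (a • M (cubicPt v) + b • M (quarticPt v)) = 0 := by
        rw [hM0, map_zero]
      simpa [wedge_self] using this
    have ha := (smul_eq_zero.1 h1).resolve_right hw0
    have hb := (smul_eq_zero.1 h2).resolve_right hw0
    exact x.rep_nonzero (by rw [← hab, ha, hb, zero_smul, zero_smul, add_zero])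
  · rintro x y ⟨h, rfl⟩
    have hw0 : pluckerVec (M (cubicPt x.rep)) (M (quarticPt x.rep)) ≠ 0 := fun h =>
      hval0 _ x.rep_nonzero (by rw [hval, wedge_apply, h, smul_zero])
    refine ⟨M (cubicPt x.rep), M (quarticPt x.rep), hw0, ?_, ?_⟩
    · rw [ruling, Submodule.map_span, Set.image_pair]
    · rw [Projectivization.mk_eq_mk_iff']
      exact ⟨r, by rw [evalVec_eq_coeffMap, hval, wedge_apply]⟩

/-! ### A member of the family is determined by its projection -/

theorem exists_wedge_eq_smul_of_mem_span {a b A B : Fin 6 → ℂ} (ha : a ∈ Submodule.span ℂ {A, B})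
    (hb : b ∈ Submodule.span ℂ {A, B}) : ∃ r : ℂ, wedge a b = r • wedge A B := by
  obtain ⟨x, y, rfl⟩ := Submodule.mem_span_pair.1 ha
  obtain ⟨z, w, rfl⟩ := Submodule.mem_span_pair.1 hb
  refine ⟨x * w - y * z, ?_⟩
  funext p
  simp only [wedge_apply, pluckerVec, Pi.add_apply, Pi.smul_apply, smul_eq_mul]
  ring

/-- Neither tuple has a common zero, so the pointwise ratio is a polynomial without zeros on the
affine chart, hence a constant. The chart (1, t) already determines all the coefficients. -/
theorem eq_smul_of_evalVec_proportional {c c' : Coeffs}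
    (h : ∀ v : Fin 2 → ℂ, v ≠ 0 → evalVec c v ≠ 0 ∧ ∃ r : ℂ, evalVec c v = r • evalVec c' v) :
    ∃ r : ℂ, c = r • c' := by
  let pol : Coeffs → PIdx → Polynomial ℂ := fun c p =>
    ∑ k : Fin 8, Polynomial.C (c (p, k)) * Polynomial.X ^ (k : ℕ)
  have hpol : ∀ c p t, (pol c p).eval t = evalVec c ![1, t] p := by
    intro c p t
    rw [evalVec_eq_coeffMap, coeffMap_apply, Finset.sum_apply]
    simp only [pol, Polynomial.eval_finsetSum, Polynomial.eval_mul, Polynomial.eval_C,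
      Polynomial.eval_pow, Polynomial.eval_X, Pi.smul_apply, smul_eq_mul]
    refine Finset.sum_congr rfl fun k _ => ?_
    simp only [veronese, coeffCol, Matrix.cons_val_zero, Matrix.cons_val_one, one_pow, one_mul]
    exact mul_comm _ _
  have hcoeff : ∀ c p (k : Fin 8), (pol c p).coeff k = c (p, k) := by
    intro c p k
    simp [pol, Polynomial.finsetSum_coeff, Polynomial.coeff_X_pow, Fin.val_inj]
  have hv : ∀ t : ℂ, (![1, t] : Fin 2 → ℂ) ≠ 0 := fun t h => one_ne_zero (congrFun h 0)
  have hcross : ∀ p q, pol c q * pol c' p = pol c p * pol c' q := by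
    refine fun p q => Polynomial.funext fun t => ?_
    obtain ⟨-, r, hr⟩ := h _ (hv t)
    rw [Polynomial.eval_mul, Polynomial.eval_mul, hpol, hpol, hpol, hpol, hr]
    simp only [Pi.smul_apply, smul_eq_mul]
    ring
  have hroot : ∀ t, ∃ p, (pol c p).eval t ≠ 0 := by
    intro t
    by_contra! hc
    exact (h _ (hv t)).1 (funext fun p => by rw [← hpol, hc]; rfl)
  have hroot' : ∀ t, ∃ p, (pol c' p).eval t ≠ 0 := by
    intro t
    by_contra! hc
    obtain ⟨h0, r, hr⟩ := h _ (hv t)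
    exact h0 (by rw [hr, show evalVec c' ![1, t] = 0 from funext fun p => by rw [← hpol, hc]; rfl,
      smul_zero])
  have htop : (1 : Polynomial ℂ) ∈ Ideal.span (Set.range (pol c')) := by
    obtain ⟨d, hd⟩ := (IsPrincipalIdealRing.principal (Ideal.span (Set.range (pol c')))).principal
    have hdvd : ∀ p, d ∣ pol c' p := fun p => by
      rw [← Ideal.mem_span_singleton]
      have : pol c' p ∈ Ideal.span (Set.range (pol c')) := Ideal.subset_span ⟨p, rfl⟩
      rwa [hd] at this
    have hdu : IsUnit d := by
      by_contra hdu
      obtain ⟨t, ht⟩ : ∃ t, d.IsRoot t := by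
        by_cases hd0 : d = 0
        · exact ⟨0, by simp [hd0]⟩
        · exact IsAlgClosed.exists_root d fun hdeg => hdu (Polynomial.isUnit_iff_degree_eq_zero.2 hdeg)
      obtain ⟨p, hp⟩ := hroot' t
      exact hp (ht.dvd (hdvd p))
    rw [hd]
    exact Ideal.mem_span_singleton.2 hdu.dvd
  -- From the Bézout relation ∑ u p * c' p = 1, the ratio is ∑ u p * c p.
  obtain ⟨u, hu⟩ := (Submodule.mem_span_range_iff_exists_fun _).1 htop
  have hfac : ∀ q, pol c q = (∑ p, u p * pol c p) * pol c' q := by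
    intro q
    calc pol c q = (∑ p, u p • pol c' p) * pol c q := by rw [hu, one_mul]
      _ = _ := by
        rw [Finset.sum_mul, Finset.sum_mul]
        refine Finset.sum_congr rfl fun p _ => ?_
        rw [smul_eq_mul, mul_assoc, mul_assoc, mul_comm (pol c' p), hcross]
  set ρ := ∑ p, u p * pol c p
  have hdeg : ρ.degree = 0 := by
    by_contra hdeg
    obtain ⟨t, ht⟩ := IsAlgClosed.exists_root ρ hdeg
    obtain ⟨p, hp⟩ := hroot t
    exact hp (by rw [hfac, Polynomial.eval_mul, ht.eq_zero, zero_mul])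
  rw [Polynomial.eq_C_of_degree_eq_zero hdeg] at hfac
  refine ⟨ρ.coeff 0, funext fun ⟨p, k⟩ => ?_⟩
  rw [← hcoeff c, hfac, Polynomial.coeff_C_mul, hcoeff c']
  rfl

theorem exists_eq_smul_projCoeffs {f : ℙ ℂ Coeffs} (hf : f ∈ Hom7) {M : C9 →ₗ[ℂ] (Fin 6 → ℂ)}
    (h : ∀ (x : P1) (y : P14), IsValue f x y → IsPluckerPoint ((ruling x.rep).map M) y) :
    ∃ r : ℂ, f.rep = r • projCoeffs M := by
  refine eq_smul_of_evalVec_proportional fun v hv => ?_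
  obtain ⟨h0, -⟩ := hf v hv
  refine ⟨h0, ?_⟩
  obtain ⟨q, hq, hqrep⟩ := rep_mk_eq_smul hv
  set x := Projectivization.mk ℂ v hv
  have hscale : ∀ c : Coeffs, evalVec c x.rep = q ^ 7 • evalVec c v := fun c => by
    rw [evalVec_eq_coeffMap, evalVec_eq_coeffMap, hqrep, veronese_smul, map_smul]
  have hx0 : evalVec f.rep x.rep ≠ 0 := by
    rw [hscale]
    exact smul_ne_zero (pow_ne_zero _ hq) h0
  obtain ⟨a, b, hab, hspan, hmk⟩ := h x _ ⟨hx0, rfl⟩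
  obtain ⟨r, hr⟩ := (Projectivization.mk_eq_mk_iff' ℂ _ _ _ _).1 hmk
  rw [ruling, Submodule.map_span, Set.image_pair] at hspan
  obtain ⟨r', hr'⟩ := exists_wedge_eq_smul_of_mem_span
    (a := a) (b := b) (A := M (cubicPt x.rep)) (B := M (quarticPt x.rep))
    (by rw [hspan]; exact Submodule.subset_span (by simp))
    (by rw [hspan]; exact Submodule.subset_span (by simp))
  refine ⟨r * r', ?_⟩
  have hq7 : q ^ 7 ≠ 0 := pow_ne_zero _ hq
  have heq : q ^ 7 • evalVec f.rep v = q ^ 7 • (r * r') • evalVec (projCoeffs M) v := by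
    rw [← hscale, ← hr, ← wedge_apply, hr', ← evalVec_projCoeffs, hscale]
    simp only [smul_smul]
    congr 1
    ring
  exact smul_right_injective _ hq7 heq

/-! ### The cone over the secant variety -/

/-- The point of the join of two rulings with parameters `q`. -/
def secantPt (q : Fin 4 × Fin 2 → ℂ) : C9 :=
  secantVec (fun m => q (0, m)) (fun m => q (1, m)) (q (2, 0)) (q (2, 1)) (q (3, 0)) (q (3, 1))

theorem exists_secantPt_eq (s t : Fin 2 → ℂ) (α β γ δ : ℂ) :
    ∃ q, secantPt q = secantVec s t α β γ δ :=
  ⟨fun x => ![s x.2, t x.2, ![α, β] x.2, ![γ, δ] x.2] x.1, rfl⟩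

theorem isPolyFun_secantPt (m : Fin 4 ⊕ Fin 5) : IsPolyFun fun q => secantPt q m := by
  rcases m with i | i
  · have : (fun q => secantPt q (Sum.inl i)) = fun q =>
        q (2, 0) * (q (0, 0) ^ (3 - (i : ℕ)) * q (0, 1) ^ (i : ℕ)) +
        q (3, 0) * (q (1, 0) ^ (3 - (i : ℕ)) * q (1, 1) ^ (i : ℕ)) := by
      funext q
      simp [secantPt, secantVec, cubicPt, quarticPt, veronese]
    rw [this]
    exact ((IsPolyFun.coord _).mul (((IsPolyFun.coord _).pow _).mul ((IsPolyFun.coord _).pow _))).add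
      ((IsPolyFun.coord _).mul (((IsPolyFun.coord _).pow _).mul ((IsPolyFun.coord _).pow _)))
  · have : (fun q => secantPt q (Sum.inr i)) = fun q =>
        q (2, 1) * (q (0, 0) ^ (4 - (i : ℕ)) * q (0, 1) ^ (i : ℕ)) +
        q (3, 1) * (q (1, 0) ^ (4 - (i : ℕ)) * q (1, 1) ^ (i : ℕ)) := by
      funext q
      simp [secantPt, secantVec, cubicPt, quarticPt, veronese]
    rw [this]
    exact ((IsPolyFun.coord _).mul (((IsPolyFun.coord _).pow _).mul ((IsPolyFun.coord _).pow _))).add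
      ((IsPolyFun.coord _).mul (((IsPolyFun.coord _).pow _).mul ((IsPolyFun.coord _).pow _)))

/-- The cone over the secant variety: all forms vanishing on the joins of pairs of rulings vanish
at `a`. -/
def InSecantCone (a : C9) : Prop :=
  ∀ (d : ℕ) (g : C9 → ℂ), IsHomFun d g → (∀ q, g (secantPt q) = 0) → g a = 0

theorem inSecantCone_secantPt (q) : InSecantCone (secantPt q) := fun _ _ _ h => h q

theorem inSecantCone_secantVec (s t : Fin 2 → ℂ) (α β γ δ : ℂ) :
    InSecantCone (secantVec s t α β γ δ) := by
  obtain ⟨q, hq⟩ := exists_secantPt_eq s t α β γ δ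
  rw [← hq]
  exact inSecantCone_secantPt q

/-- A form that vanishes at every `secantPt` cuts out a closed set containing all secant lines,
hence their closure. -/
theorem inSecantCone_rep {x : ℙ ℂ C9} (hx : x ∈ secS34) : InSecantCone x.rep := by
  rintro d g ⟨P, hP, hg⟩ h
  rw [hg]
  refine hx {z | MvPolynomial.eval z.rep P = 0} ⟨{P}, ?_, ?_⟩ ?_
  · rintro F rfl
    exact ⟨d, hP⟩
  · ext z
    exact ⟨fun hz F hF => by rw [Set.mem_singleton_iff.1 hF]; exact hz, fun hz => hz P rfl⟩
  · rintro z ⟨y, ⟨s, -, hy⟩, y', ⟨t, -, hy'⟩, -, hz⟩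
    have hzr : z.rep ∈ y.submodule ⊔ y'.submodule := by
      apply hz
      rw [Projectivization.submodule_eq]
      exact Submodule.mem_span_singleton_self _
    obtain ⟨u, hu, u', hu', huu⟩ := Submodule.mem_sup.1 hzr
    obtain ⟨α, β, rfl⟩ := Submodule.mem_span_pair.1 (hy hu)
    obtain ⟨γ, δ, rfl⟩ := Submodule.mem_span_pair.1 (hy' hu')
    obtain ⟨q, hq⟩ := exists_secantPt_eq s t α β γ δ
    change MvPolynomial.eval z.rep P = 0
    rw [← huu, ← hg]
    rw [secantVec] at hq
    rw [← hq]
    exact h q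

theorem IsHomFun.eval_smul {τ : Type*} {d : ℕ} {g : (τ → ℂ) → ℂ} (hg : IsHomFun d g) (r : ℂ)
    (x : τ → ℂ) : g (r • x) = r ^ d * g x := by
  obtain ⟨P, hP, hg⟩ := hg
  rw [hg, hg, MvPolynomial.eval_eq, MvPolynomial.eval_eq, Finset.mul_sum]
  refine Finset.sum_congr rfl fun k hk => ?_
  have hd : ∑ i ∈ k.support, k i = d := (hP.degree_eq_sum_deg_support hk).symm
  simp only [Pi.smul_apply, smul_eq_mul, mul_pow, Finset.prod_mul_distrib]
  rw [Finset.prod_pow_eq_pow_sum, hd]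
  ring

theorem IsHomFun.continuous {τ : Type*} {d : ℕ} {g : (τ → ℂ) → ℂ} (hg : IsHomFun d g) :
    Continuous g := by
  obtain ⟨P, -, hg⟩ := hg
  rw [show g = fun x => MvPolynomial.eval x P from funext hg]
  exact MvPolynomial.continuous_eval P

/-- Limits of secant points lie in the cone over the secant variety. -/
theorem InSecantCone.of_continuous {γ : ℂ → C9} (hγ : Continuous γ)
    (h : ∀ z, z ≠ 0 → InSecantCone (γ z)) : InSecantCone (γ 0) := by
  intro d g hg hz
  have hc : Continuous fun z => g (γ z) := hg.continuous.comp hγ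
  have h0 : (fun z => g (γ z)) = fun _ => 0 := by
    refine Continuous.ext_on (dense_compl_singleton (0 : ℂ)) hc continuous_const fun z hz' => ?_
    exact h z hz' d g hg hz
  exact congrFun h0 0

/-- The arguments are specialized one at a time. `InSecantCone` only tests homogeneous functions,
which is why R must be homogeneous in each argument separately. -/
theorem eq_zero_of_inSecantCone {R : C9 → C9 → C9 → ℂ} {d : ℕ}
    (h₁ : ∀ b c, IsHomFun d fun a => R a b c) (h₂ : ∀ a c, IsHomFun d fun b => R a b c)
    (h₃ : ∀ a b, IsHomFun d fun c => R a b c)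
    (h : ∀ q q' q'', R (secantPt q) (secantPt q') (secantPt q'') = 0) {a b c : C9}
    (ha : InSecantCone a) (hb : InSecantCone b) (hc : InSecantCone c) : R a b c = 0 :=
  ha d _ (h₁ b c) fun q => hb d _ (h₂ _ c) fun q' => hc d _ (h₃ _ _) fun q'' => h q q' q''

/-! ### Projections with varying center -/

/-- The determinant of the values of three linear forms at three vectors. -/
def tripleDet (l : Fin 3 → C9 →ₗ[ℂ] ℂ) (x y z : C9) : ℂ :=
  l 0 x * (l 1 y * l 2 z - l 2 y * l 1 z) - l 1 x * (l 0 y * l 2 z - l 2 y * l 0 z) +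
    l 2 x * (l 0 y * l 1 z - l 1 y * l 0 z)

/-- A multiple of the projection along `a`, `b`, `c` to the common kernel of three linear forms,
polynomial in `a`, `b`, `c`. -/
def projAlong (l : Fin 3 → C9 →ₗ[ℂ] ℂ) (a b c : C9) : C9 →ₗ[ℂ] C9 where
  toFun x := tripleDet l a b c • x - tripleDet l x b c • a - tripleDet l a x c • b -
    tripleDet l a b x • c
  map_add' x y := by
    simp only [tripleDet, map_add]
    module
  map_smul' r x := by
    simp only [tripleDet, map_smul, smul_eq_mul, RingHom.id_apply]
    module

theorem projAlong_apply (l : Fin 3 → C9 →ₗ[ℂ] ℂ) (a b c x : C9) :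
    projAlong l a b c x = tripleDet l a b c • x - tripleDet l x b c • a - tripleDet l a x c • b -
      tripleDet l a b x • c := rfl

theorem projAlong_self (l : Fin 3 → C9 →ₗ[ℂ] ℂ) (a : Fin 3 → C9) (i : Fin 3) :
    projAlong l (a 0) (a 1) (a 2) (a i) = 0 := by
  fin_cases i <;> simp only [projAlong_apply, tripleDet, Fin.zero_eta, Fin.mk_one, Fin.reduceFinMk]
  all_goals module

theorem apply_projAlong (l : Fin 3 → C9 →ₗ[ℂ] ℂ) (a b c x : C9) (i : Fin 3) :
    l i (projAlong l a b c x) = 0 := by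
  simp only [projAlong_apply, map_sub, map_smul, smul_eq_mul, tripleDet]
  fin_cases i <;> simp only [Fin.zero_eta, Fin.mk_one, Fin.reduceFinMk] <;> ring

/-- Cramer's rule: a nonzero determinant makes the common kernel of the three forms complementary to
the span of the a i. -/
theorem eq_zero_of_tripleDet_ne_zero {l : Fin 3 → C9 →ₗ[ℂ] ℂ} {a : Fin 3 → C9}
    (h : tripleDet l (a 0) (a 1) (a 2) ≠ 0) {x : Fin 3 → ℂ}
    (hx : ∀ i, l i (∑ j, x j • a j) = 0) : x = 0 := by
  have e : ∀ i, x 0 * l i (a 0) + x 1 * l i (a 1) + x 2 * l i (a 2) = 0 := fun i => by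
    simpa [Fin.sum_univ_three] using hx i
  have e0 := e 0
  have e1 := e 1
  have e2 := e 2
  have h0 : tripleDet l (a 0) (a 1) (a 2) * x 0 = 0 := by
    simp only [tripleDet]
    linear_combination (l 1 (a 1) * l 2 (a 2) - l 2 (a 1) * l 1 (a 2)) * e0 -
      (l 0 (a 1) * l 2 (a 2) - l 2 (a 1) * l 0 (a 2)) * e1 +
      (l 0 (a 1) * l 1 (a 2) - l 1 (a 1) * l 0 (a 2)) * e2
  have h1 : tripleDet l (a 0) (a 1) (a 2) * x 1 = 0 := by
    simp only [tripleDet]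
    linear_combination -(l 1 (a 0) * l 2 (a 2) - l 2 (a 0) * l 1 (a 2)) * e0 +
      (l 0 (a 0) * l 2 (a 2) - l 2 (a 0) * l 0 (a 2)) * e1 -
      (l 0 (a 0) * l 1 (a 2) - l 1 (a 0) * l 0 (a 2)) * e2
  have h2 : tripleDet l (a 0) (a 1) (a 2) * x 2 = 0 := by
    simp only [tripleDet]
    linear_combination (l 1 (a 0) * l 2 (a 1) - l 2 (a 0) * l 1 (a 1)) * e0 -
      (l 0 (a 0) * l 2 (a 1) - l 2 (a 0) * l 0 (a 1)) * e1 +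
      (l 0 (a 0) * l 1 (a 1) - l 1 (a 0) * l 0 (a 1)) * e2
  funext i
  fin_cases i
  · exact (mul_eq_zero.1 h0).resolve_left h
  · exact (mul_eq_zero.1 h1).resolve_left h
  · exact (mul_eq_zero.1 h2).resolve_left h

theorem linearIndependent_of_tripleDet_ne_zero {l : Fin 3 → C9 →ₗ[ℂ] ℂ} {a : Fin 3 → C9}
    (h : tripleDet l (a 0) (a 1) (a 2) ≠ 0) : LinearIndependent ℂ a :=
  Fintype.linearIndependent_iff.2 fun x hx => congrFun <| eq_zero_of_tripleDet_ne_zero h fun i => by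
    rw [hx, map_zero]

/-! ### Moving the center of a projection with a fixed complement. -/

section Moving

variable {M : C9 →ₗ[ℂ] (Fin 6 → ℂ)} (hM : Function.Surjective M) {a₀ : Fin 3 → C9}
  (hker : LinearMap.ker M = Submodule.span ℂ (Set.range a₀)) {l : Fin 3 → C9 →ₗ[ℂ] ℂ}
  (h₀ : tripleDet l (a₀ 0) (a₀ 1) (a₀ 2) ≠ 0) {a : Fin 3 → C9}
  (h : tripleDet l (a 0) (a 1) (a 2) ≠ 0)

include hker in
theorem apply_eq_zero_of_center (i : Fin 3) : M (a₀ i) = 0 := by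
  rw [← LinearMap.mem_ker, hker]
  exact Submodule.subset_span ⟨i, rfl⟩

include hker in
-- At the original center the moving projection is a nonzero multiple of M as soon as the
-- determinant is nonzero, so the nonvanishing of forms is preserved there.
theorem comp_projAlong_self : M ∘ₗ projAlong l (a₀ 0) (a₀ 1) (a₀ 2) =
    tripleDet l (a₀ 0) (a₀ 1) (a₀ 2) • M := by
  refine LinearMap.ext fun x => ?_
  simp only [LinearMap.comp_apply, projAlong_apply, map_sub, map_smul, apply_eq_zero_of_center hker,
    smul_zero, sub_zero, LinearMap.smul_apply]

include hM hker h₀ h in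
theorem surjective_comp_projAlong :
    Function.Surjective (M ∘ₗ projAlong l (a 0) (a 1) (a 2)) := by
  intro y
  obtain ⟨z, rfl⟩ := hM y
  set u := projAlong l (a₀ 0) (a₀ 1) (a₀ 2) z with hu
  have hlu : ∀ i, l i u = 0 := fun i => apply_projAlong _ _ _ _ _ i
  have hMu : M u = tripleDet l (a₀ 0) (a₀ 1) (a₀ 2) • M z :=
    LinearMap.congr_fun (comp_projAlong_self (l := l) hker) z
  have hPu : projAlong l (a 0) (a 1) (a 2) u = tripleDet l (a 0) (a 1) (a 2) • u := by
    simp [projAlong_apply, tripleDet, hlu]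
  refine ⟨(tripleDet l (a₀ 0) (a₀ 1) (a₀ 2))⁻¹ • (tripleDet l (a 0) (a 1) (a 2))⁻¹ • u, ?_⟩
  rw [map_smul, map_smul, LinearMap.comp_apply, hPu, map_smul, hMu, smul_smul, smul_smul, smul_smul]
  rw [inv_mul_cancel_right₀ h, inv_mul_cancel₀ h₀, one_smul]

include hker h₀ h in
-- The image of `projAlong` lies in the common kernel of the forms l, which meets the kernel of M
-- trivially. So the composite has the same kernel as `projAlong`.
theorem ker_comp_projAlong : LinearMap.ker (M ∘ₗ projAlong l (a 0) (a 1) (a 2)) =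
    Submodule.span ℂ (Set.range a) := by
  refine le_antisymm (fun x hx => ?_) ?_
  · rw [LinearMap.mem_ker, LinearMap.comp_apply, ← LinearMap.mem_ker, hker,
      Submodule.mem_span_range_iff_exists_fun] at hx
    obtain ⟨y, hy⟩ := hx
    have hy0 : y = 0 := eq_zero_of_tripleDet_ne_zero h₀ fun i => by
      rw [hy, apply_projAlong]
    have hP : projAlong l (a 0) (a 1) (a 2) x = 0 := by
      rw [← hy, hy0]
      simp
    rw [projAlong_apply, sub_sub, sub_sub, sub_eq_zero] at hP
    have hx : x = (tripleDet l (a 0) (a 1) (a 2))⁻¹ • (tripleDet l x (a 1) (a 2) • a 0 +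
        (tripleDet l (a 0) x (a 2) • a 1 + tripleDet l (a 0) (a 1) x • a 2)) := by
      rw [← hP, smul_smul, inv_mul_cancel₀ h, one_smul]
    have hmem : ∀ i, a i ∈ Submodule.span ℂ (Set.range a) := fun i => Submodule.subset_span ⟨i, rfl⟩
    rw [hx]
    exact Submodule.smul_mem _ _ (Submodule.add_mem _ (Submodule.smul_mem _ _ (hmem 0))
      (Submodule.add_mem _ (Submodule.smul_mem _ _ (hmem 1)) (Submodule.smul_mem _ _ (hmem 2))))
  · rw [Submodule.span_le]
    rintro _ ⟨i, rfl⟩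
    simp [projAlong_self l a i]

end Moving

theorem projCoeffs_smul (r : ℂ) (M : C9 →ₗ[ℂ] (Fin 6 → ℂ)) :
    projCoeffs (r • M) = (r * r) • projCoeffs M := by
  funext q
  simp only [projCoeffs, antidiagSum, LinearMap.smul_apply, map_smul, Finset.sum_apply,
    Pi.smul_apply, smul_eq_mul, Finset.mul_sum]
  refine Finset.sum_congr rfl fun i _ => Finset.sum_congr rfl fun j _ => ?_
  split_ifs
  · simp only [Pi.smul_apply, smul_eq_mul]
    ring
  · simp

theorem isHomFun_projCoeffs {τ : Type*} {d : ℕ} {N : (τ → ℂ) → C9 →ₗ[ℂ] (Fin 6 → ℂ)}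
    (hN : ∀ y p, IsHomFun d fun x => N x y p) (q : PIdx × Fin 8) :
    IsHomFun (d + d) fun x => projCoeffs (N x) q := by
  simp only [projCoeffs, antidiagSum, Finset.sum_apply]
  refine IsHomFun.sum _ fun i => IsHomFun.sum _ fun j => ?_
  split_ifs
  · exact ((hN _ _).mul (hN _ _)).sub ((hN _ _).mul (hN _ _))
  · exact IsHomFun.zero _

theorem isPolyFun_projCoeffs {τ : Type*} {N : (τ → ℂ) → C9 →ₗ[ℂ] (Fin 6 → ℂ)}
    (hN : ∀ y p, IsPolyFun fun x => N x y p) (q : PIdx × Fin 8) :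
    IsPolyFun fun x => projCoeffs (N x) q := by
  simp only [projCoeffs, antidiagSum, Finset.sum_apply]
  refine IsPolyFun.sum _ fun i => IsPolyFun.sum _ fun j => ?_
  split_ifs
  · exact ((hN _ _).mul (hN _ _)).sub ((hN _ _).mul (hN _ _))
  · exact IsPolyFun.const _

theorem isHomFun_apply_apply (M : C9 →ₗ[ℂ] (Fin 6 → ℂ)) (p : Fin 6) :
    IsHomFun 1 fun x => M x p :=
  IsHomFun.linear (LinearMap.proj p ∘ₗ M)

/-! ### Separate homogeneity in the points spanning the center. -/

section TripleDet

variable (l : Fin 3 → C9 →ₗ[ℂ] ℂ)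

theorem isHomFun_tripleDet_left (y z : C9) : IsHomFun 1 fun x => tripleDet l x y z := by
  simp only [tripleDet, mul_comm (l _ _) (_ - _)]
  exact (((IsHomFun.linear _).const_mul _).sub ((IsHomFun.linear _).const_mul _)).add
    ((IsHomFun.linear _).const_mul _)

theorem tripleDet_rotate (x y z : C9) : tripleDet l x y z = tripleDet l y z x := by
  simp only [tripleDet]
  ring

theorem isHomFun_tripleDet_middle (x z : C9) : IsHomFun 1 fun y => tripleDet l x y z := by
  simp only [tripleDet_rotate l x]
  exact isHomFun_tripleDet_left l z x

theorem isHomFun_tripleDet_right (x y : C9) : IsHomFun 1 fun z => tripleDet l x y z := by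
  simp only [← tripleDet_rotate l _ x y]
  exact isHomFun_tripleDet_left l x y

theorem isPolyFun_tripleDet {τ : Type*} {x y z : (τ → ℂ) → C9}
    (hx : ∀ m, IsPolyFun fun t => x t m) (hy : ∀ m, IsPolyFun fun t => y t m)
    (hz : ∀ m, IsPolyFun fun t => z t m) : IsPolyFun fun t => tripleDet l (x t) (y t) (z t) := by
  have h : ∀ i {x : (τ → ℂ) → C9}, (∀ m, IsPolyFun fun t => x t m) → IsPolyFun fun t => l i (x t) :=
    fun i x hx => (IsHomFun.linear (l i)).isPolyFun.comp hx
  exact (((h 0 hx).mul (((h 1 hy).mul (h 2 hz)).sub ((h 2 hy).mul (h 1 hz)))).sub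
    ((h 1 hx).mul (((h 0 hy).mul (h 2 hz)).sub ((h 2 hy).mul (h 0 hz))))).add
    ((h 2 hx).mul (((h 0 hy).mul (h 1 hz)).sub ((h 1 hy).mul (h 0 hz))))

variable (M : C9 →ₗ[ℂ] (Fin 6 → ℂ))

theorem comp_projAlong_apply_apply (a b c x : C9) (p : Fin 6) :
    (M ∘ₗ projAlong l a b c) x p = tripleDet l a b c * M x p - tripleDet l x b c * M a p -
      tripleDet l a x c * M b p - tripleDet l a b x * M c p := by
  simp [projAlong_apply]

/-- A form in the coefficients of the ruling map, as a function of the points spanning the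
center. -/
def evalCenter (F : MvPolynomial (PIdx × Fin 8) ℂ) (a b c : C9) : ℂ :=
  MvPolynomial.eval (projCoeffs (M ∘ₗ projAlong l a b c)) F

variable {F : MvPolynomial (PIdx × Fin 8) ℂ}

theorem isPolyFun_evalCenter {τ : Type*} {x y z : (τ → ℂ) → C9}
    (hx : ∀ m, IsPolyFun fun t => x t m) (hy : ∀ m, IsPolyFun fun t => y t m)
    (hz : ∀ m, IsPolyFun fun t => z t m) :
    IsPolyFun fun t => evalCenter l M F (x t) (y t) (z t) := by
  refine (IsPolyFun.eval F).comp (isPolyFun_projCoeffs fun u p => ?_)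
  simp only [comp_projAlong_apply_apply]
  have h : ∀ {x : (τ → ℂ) → C9}, (∀ m, IsPolyFun fun t => x t m) → IsPolyFun fun t => M (x t) p :=
    fun hx => (isHomFun_apply_apply M p).isPolyFun.comp hx
  have hu : ∀ m, IsPolyFun fun _ : τ → ℂ => u m := fun m => IsPolyFun.const _
  exact ((((isPolyFun_tripleDet l hx hy hz).mul (h hu)).sub
    ((isPolyFun_tripleDet l hu hy hz).mul (h hx))).sub
    ((isPolyFun_tripleDet l hx hu hz).mul (h hy))).sub
    ((isPolyFun_tripleDet l hx hy hu).mul (h hz))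

variable {d : ℕ} (hF : F.IsHomogeneous d)
include hF

/-- The projection is linear in each spanning point and the Plücker coefficients are quadratic in
the projection, whence the factor 1 + 1. -/
theorem isHomFun_evalCenter_left (b c : C9) :
    IsHomFun ((1 + 1) * d) fun a => evalCenter l M F a b c := by
  refine IsHomFun.comp (F := fun x => MvPolynomial.eval x F) ⟨F, hF, fun _ => rfl⟩
    (isHomFun_projCoeffs fun u p => ?_)
  simp only [comp_projAlong_apply_apply, mul_comm _ (M _ p)]
  exact ((((isHomFun_tripleDet_left l b c).const_mul _).sub
    (by simpa only [mul_comm] using (isHomFun_apply_apply M p).const_mul (tripleDet l u b c))).sub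
    ((isHomFun_tripleDet_left l u c).const_mul _)).sub
    ((isHomFun_tripleDet_left l b u).const_mul _)

theorem isHomFun_evalCenter_middle (a c : C9) :
    IsHomFun ((1 + 1) * d) fun b => evalCenter l M F a b c := by
  refine IsHomFun.comp (F := fun x => MvPolynomial.eval x F) ⟨F, hF, fun _ => rfl⟩
    (isHomFun_projCoeffs fun u p => ?_)
  simp only [comp_projAlong_apply_apply, mul_comm _ (M _ p)]
  exact ((((isHomFun_tripleDet_middle l a c).const_mul _).sub
    ((isHomFun_tripleDet_middle l u c).const_mul _)).sub
    (by simpa only [mul_comm] using (isHomFun_apply_apply M p).const_mul (tripleDet l a u c))).sub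
    ((isHomFun_tripleDet_middle l a u).const_mul _)

theorem isHomFun_evalCenter_right (a b : C9) :
    IsHomFun ((1 + 1) * d) fun c => evalCenter l M F a b c := by
  refine IsHomFun.comp (F := fun x => MvPolynomial.eval x F) ⟨F, hF, fun _ => rfl⟩
    (isHomFun_projCoeffs fun u p => ?_)
  simp only [comp_projAlong_apply_apply, mul_comm _ (M _ p)]
  exact ((((isHomFun_tripleDet_right l a b).const_mul _).sub
    ((isHomFun_tripleDet_right l u b).const_mul _)).sub
    ((isHomFun_tripleDet_right l a u).const_mul _)).sub
    (by simpa only [mul_comm] using (isHomFun_apply_apply M p).const_mul (tripleDet l a b u))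

end TripleDet

/-! ### Linear forms in general position -/

theorem exists_tripleDet_eq_one {a : Fin 3 → C9} (ha : LinearIndependent ℂ a) :
    ∃ l, tripleDet l (a 0) (a 1) (a 2) = 1 := by
  obtain ⟨g, hg⟩ := LinearMap.exists_leftInverse_of_injective (Fintype.linearCombination ℂ a)
    (LinearMap.ker_eq_bot.2 ha.fintypeLinearCombination_injective)
  have h : ∀ j, g (a j) = Pi.single j 1 := by
    intro j
    have := LinearMap.congr_fun hg (Pi.single j 1)
    simpa [Fintype.linearCombination_apply, Pi.single_apply] using this
  exact ⟨fun i => LinearMap.proj i ∘ₗ g, by simp [tripleDet, h]⟩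

/-- The linear forms with the given coefficients. -/
def formsOfCoeffs (x : Fin 3 × (Fin 4 ⊕ Fin 5) → ℂ) (i : Fin 3) : C9 →ₗ[ℂ] ℂ :=
  Fintype.linearCombination ℂ fun m => x (i, m)

theorem exists_formsOfCoeffs_eq (l : Fin 3 → C9 →ₗ[ℂ] ℂ) : ∃ x, formsOfCoeffs x = l := by
  refine ⟨fun q => l q.1 (Pi.single q.2 1), ?_⟩
  funext i
  refine LinearMap.pi_ext' fun m => LinearMap.ext_ring ?_
  simp [formsOfCoeffs, Fintype.linearCombination_apply, Pi.single_apply]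

theorem isPolyFun_tripleDet_formsOfCoeffs (a b c : C9) :
    IsPolyFun fun x => tripleDet (formsOfCoeffs x) a b c := by
  have h : ∀ i (a : C9), IsPolyFun fun x => formsOfCoeffs x i a := by
    intro i a
    simp only [formsOfCoeffs, Fintype.linearCombination_apply, smul_eq_mul]
    exact IsPolyFun.sum _ fun m => (IsPolyFun.const _).mul (IsPolyFun.coord _)
  exact (((h 0 a).mul (((h 1 b).mul (h 2 c)).sub ((h 2 b).mul (h 1 c)))).sub
    ((h 1 a).mul (((h 0 b).mul (h 2 c)).sub ((h 2 b).mul (h 0 c))))).add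
    ((h 2 a).mul (((h 0 b).mul (h 1 c)).sub ((h 1 b).mul (h 0 c))))

/-- Two 3-dimensional subspaces have a common complement: each determinant is a nonzero polynomial
in the coefficients of the forms, and so is their product. -/
theorem exists_tripleDet_ne_zero {a a' : Fin 3 → C9} (ha : LinearIndependent ℂ a)
    (ha' : LinearIndependent ℂ a') : ∃ l, tripleDet l (a 0) (a 1) (a 2) ≠ 0 ∧
      tripleDet l (a' 0) (a' 1) (a' 2) ≠ 0 := by
  obtain ⟨l, hl⟩ := exists_tripleDet_eq_one ha
  obtain ⟨l', hl'⟩ := exists_tripleDet_eq_one ha'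
  obtain ⟨x, rfl⟩ := exists_formsOfCoeffs_eq l
  obtain ⟨x', rfl⟩ := exists_formsOfCoeffs_eq l'
  obtain ⟨y, hy⟩ := IsPolyFun.exists_mul_ne_zero
    (isPolyFun_tripleDet_formsOfCoeffs (a 0) (a 1) (a 2))
    (isPolyFun_tripleDet_formsOfCoeffs (a' 0) (a' 1) (a' 2))
    ⟨x, by rw [hl]; exact one_ne_zero⟩ ⟨x', by rw [hl']; exact one_ne_zero⟩
  exact ⟨formsOfCoeffs y, left_ne_zero_of_mul hy, right_ne_zero_of_mul hy⟩

/-! ### A plane spanned by three points of the secant variety -/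

/-- The relation is linear in each of the four vectors, so it extends from the standard basis one
slot at a time. It is needed in the basis `specialVec`. -/
theorem IsDecomposable.bil_plucker {w : Fin 6 × Fin 6 → ℂ} (hw : IsDecomposable w)
    (x y z u : Fin 6 → ℂ) :
    bil w x y * bil w z u - bil w x z * bil w y u + bil w x u * bil w y z = 0 := by
  let e : Fin 6 → Fin 6 → ℂ := fun i => Pi.single i 1
  have hT : ∀ T : (Fin 6 → ℂ) →ₗ[ℂ] ℂ, (∀ i, T (e i) = 0) → ∀ x, T x = 0 := fun T hT x => by
    have : T = 0 := LinearMap.pi_ext' fun i => LinearMap.ext_ring (by simpa [e] using hT i)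
    rw [this, LinearMap.zero_apply]
  have h0 : ∀ i j k l, bil w (e i) (e j) * bil w (e k) (e l) -
      bil w (e i) (e k) * bil w (e j) (e l) + bil w (e i) (e l) * bil w (e j) (e k) = 0 :=
    fun i j k l => by simpa only [e, bil_single] using hw.plucker i j k l
  have h1 : ∀ i j k u, bil w (e i) (e j) * bil w (e k) u -
      bil w (e i) (e k) * bil w (e j) u + bil w (e i) u * bil w (e j) (e k) = 0 := by
    intro i j k u
    have := hT (bil w (e i) (e j) • bil w (e k) - bil w (e i) (e k) • bil w (e j) +
      bil w (e j) (e k) • bil w (e i)) (fun l => by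
        simp only [LinearMap.add_apply, LinearMap.sub_apply, LinearMap.smul_apply, smul_eq_mul]
        linear_combination h0 i j k l) u
    simp only [LinearMap.add_apply, LinearMap.sub_apply, LinearMap.smul_apply, smul_eq_mul] at this
    linear_combination this
  have h2 : ∀ i j z u, bil w (e i) (e j) * bil w z u -
      bil w (e i) z * bil w (e j) u + bil w (e i) u * bil w (e j) z = 0 := by
    intro i j z u
    have := hT (bil w (e i) (e j) • (bil w).flip u - bil w (e j) u • bil w (e i) +
      bil w (e i) u • bil w (e j)) (fun k => by
        simp only [LinearMap.add_apply, LinearMap.sub_apply, LinearMap.smul_apply, smul_eq_mul,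
          LinearMap.flip_apply]
        linear_combination h1 i j k u) z
    simp only [LinearMap.add_apply, LinearMap.sub_apply, LinearMap.smul_apply, smul_eq_mul,
      LinearMap.flip_apply] at this
    linear_combination this
  have h3 : ∀ i y z u, bil w (e i) y * bil w z u -
      bil w (e i) z * bil w y u + bil w (e i) u * bil w y z = 0 := by
    intro i y z u
    have := hT (bil w z u • bil w (e i) - bil w (e i) z • (bil w).flip u +
      bil w (e i) u • (bil w).flip z) (fun j => by
        simp only [LinearMap.add_apply, LinearMap.sub_apply, LinearMap.smul_apply, smul_eq_mul,
          LinearMap.flip_apply]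
        linear_combination h2 i j z u) y
    simp only [LinearMap.add_apply, LinearMap.sub_apply, LinearMap.smul_apply, smul_eq_mul,
      LinearMap.flip_apply] at this
    linear_combination this
  have := hT (bil w z u • (bil w).flip y - bil w y u • (bil w).flip z +
    bil w y z • (bil w).flip u) (fun i => by
      simp only [LinearMap.add_apply, LinearMap.sub_apply, LinearMap.smul_apply, smul_eq_mul,
        LinearMap.flip_apply]
      linear_combination h3 i y z u) x
  simp only [LinearMap.add_apply, LinearMap.sub_apply, LinearMap.smul_apply, smul_eq_mul,
    LinearMap.flip_apply] at this
  linear_combination this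

/-- The relations h1 to h14 cut out five points of ℙ⁶: the coordinate points of A, B, u and v, and
the point v = -w with all other coordinates zero. The form A + B + u + v is nonzero at each of them.
-/
theorem eq_zero_of_specialPlane_equations {A B s u v w x : ℂ} (h1 : A * (s + u) = 0)
    (h2 : A * u = 0) (h3 : A * B + s * (u - x) = 0) (h4 : A * x - s * u = 0)
    (h5 : s * (s + u) = 0) (h6 : v * (s + u) = 0) (h7 : -(s * w) + v * B = 0)
    (h8 : (u - x) * (v + w) = 0) (h9 : u * (x + s) = 0) (h10 : u * (v + w) = 0)
    (h11 : (u - x) * x + u * B = 0) (h12 : (s + u) * x - (v + w) * w + u * B = 0)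
    (h13 : A * (v + w) = 0) (h14 : A * w + v * (u - x) = 0)
    (hH : A + B + u + v = 0) : A = 0 ∧ B = 0 ∧ s = 0 ∧ u = 0 ∧ v = 0 ∧ w = 0 ∧ x = 0 := by
  have hA : A = 0 := by
    by_contra hA
    have hu : u = 0 := (mul_eq_zero.1 h2).resolve_left hA
    have hs : s = 0 := (mul_eq_zero.1 (by linear_combination h1 - h2 : A * s = 0)).resolve_left hA
    subst hu hs
    have hB : B = 0 := (mul_eq_zero.1 (by linear_combination h3 : A * B = 0)).resolve_left hA
    subst hB
    have hx : x = 0 := (mul_eq_zero.1 (by linear_combination h4 : A * x = 0)).resolve_left hA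
    subst hx
    exact pow_ne_zero 2 hA (by linear_combination A * hH - h13 + h14 : A ^ 2 = 0)
  subst hA
  have hs : s = 0 := pow_eq_zero_iff two_ne_zero |>.1 (by linear_combination h5 + h4 : s ^ 2 = 0)
  subst hs
  have hv : v = 0 := by
    by_contra hv
    have hu : u = 0 := (mul_eq_zero.1 (by linear_combination h6 : v * u = 0)).resolve_left hv
    have hB : B = 0 := (mul_eq_zero.1 (by linear_combination h7 : v * B = 0)).resolve_left hv
    exact hv (by linear_combination hH - hu - hB)
  subst hv
  have hw : w = 0 := pow_eq_zero_iff three_ne_zero |>.1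
    (by linear_combination -w * h12 + B * h10 + w * h9 : w ^ 3 = 0)
  have hx : x = 0 := pow_eq_zero_iff three_ne_zero |>.1
    (by linear_combination -x * h11 + (x + B) * h9 : x ^ 3 = 0)
  subst hw hx
  have hu : u = 0 := pow_eq_zero_iff two_ne_zero |>.1
    (by linear_combination u * hH - h11 : u ^ 2 = 0)
  exact ⟨rfl, by linear_combination hH - hu, rfl, hu, rfl, rfl, rfl⟩

/-- Three independent points of the cone over the secant variety. -/
def specialCenter : Fin 3 → C9 :=
  ![cubicVec 1 + quarticVec 0, quarticVec 0 + quarticVec 4, cubicVec 2 + quarticVec 3]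

/-- The second point lies on an honest secant line. The first and third are limits, as z tends to 0,
of secant points whose two rulings come together over (1, 0) and (0, 1) respectively. -/
theorem inSecantCone_specialCenter (i : Fin 3) : InSecantCone (specialCenter i) := by
  fin_cases i
  · have h := InSecantCone.of_continuous
      (γ := fun z => cubicVec 1 + quarticVec 0 + z • cubicVec 2 + z ^ 2 • cubicVec 3)
      (by fun_prop) fun z hz => by
        convert inSecantCone_secantVec ![1, z] ![1, 0] (1 / z) 0 (-1 / z) 1 using 1
        funext m
        rcases m with m | m <;> fin_cases m <;>
          simp [secantVec, cubicPt, quarticPt, veronese, cubicVec, quarticVec, hz]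
        all_goals field_simp
        all_goals ring
    simpa [specialCenter] using h
  · convert inSecantCone_secantVec ![1, 0] ![0, 1] 0 1 0 1 using 1
    funext m
    rcases m with m | m <;> fin_cases m <;>
      simp [specialCenter, secantVec, quarticPt, cubicPt, veronese, cubicVec, quarticVec]
  · have h := InSecantCone.of_continuous
      (γ := fun z => cubicVec 2 + quarticVec 3 + z • (cubicVec 1 + quarticVec 2) +
        z ^ 2 • (cubicVec 0 + quarticVec 1) + z ^ 3 • quarticVec 0)
      (by fun_prop) fun z hz => by
        convert inSecantCone_secantVec ![z, 1] ![0, 1] (1 / z) (1 / z) (-1 / z) (-1 / z) using 1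
        funext m
        rcases m with m | m <;> fin_cases m <;>
          simp [secantVec, cubicPt, quarticPt, veronese, cubicVec, quarticVec, hz]
        all_goals field_simp
        all_goals ring
    simpa [specialCenter] using h

theorem linearIndependent_specialCenter : LinearIndependent ℂ specialCenter := by
  refine Fintype.linearIndependent_iff.2 fun x hx => ?_
  have h0 := congrFun hx (Sum.inl 1)
  have h1 := congrFun hx (Sum.inr 4)
  have h2 := congrFun hx (Sum.inl 2)
  simp [Fin.sum_univ_three, specialCenter, cubicVec, quarticVec] at h0 h1 h2
  intro i
  fin_cases i <;> assumption

theorem exists_surjective_ker_eq_span {a : Fin 3 → C9} (ha : LinearIndependent ℂ a) :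
    ∃ M : C9 →ₗ[ℂ] (Fin 6 → ℂ), Function.Surjective M ∧
      LinearMap.ker M = Submodule.span ℂ (Set.range a) := by
  set K := Submodule.span ℂ (Set.range a) with hK
  have h3 : Module.finrank ℂ K = 3 := by simpa using finrank_span_eq_card ha
  have h9 : Module.finrank ℂ C9 = 9 := by simp
  have h := K.finrank_quotient_add_finrank
  let φ : (C9 ⧸ K) ≃ₗ[ℂ] (Fin 6 → ℂ) := LinearEquiv.ofFinrankEq _ _ (by simp; omega)
  refine ⟨φ.toLinearMap ∘ₗ K.mkQ, φ.surjective.comp K.mkQ_surjective, ?_⟩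
  rw [LinearEquiv.ker_comp, Submodule.ker_mkQ]

theorem forall_antidiagSum_eq {E : Type*} [AddCommMonoid E] (g : Fin 4 → Fin 5 → E) :
    antidiagSum 0 g = g 0 0 ∧ antidiagSum 1 g = g 0 1 + g 1 0 ∧
    antidiagSum 2 g = g 0 2 + (g 1 1 + g 2 0) ∧
    antidiagSum 3 g = g 0 3 + (g 1 2 + (g 2 1 + g 3 0)) ∧
    antidiagSum 4 g = g 0 4 + (g 1 3 + (g 2 2 + g 3 1)) ∧
    antidiagSum 5 g = g 1 4 + (g 2 3 + g 3 2) ∧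
    antidiagSum 6 g = g 2 4 + g 3 3 ∧ antidiagSum 7 g = g 3 4 := by
  refine ⟨?_, ?_, ?_, ?_, ?_, ?_, ?_, ?_⟩ <;> simp [antidiagSum, Fin.sum_univ_succ]

/-! ### Genericity of the projection from the special plane. -/

section SpecialCenter

variable {M : C9 →ₗ[ℂ] (Fin 6 → ℂ)} (hM : Function.Surjective M)
  (hker : LinearMap.ker M = Submodule.span ℂ (Set.range specialCenter))

/-- Six of the images of the coordinate vectors of `ℂ⁹`. -/
def specialVec (M : C9 →ₗ[ℂ] (Fin 6 → ℂ)) : Fin 6 → Fin 6 → ℂ :=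
  ![M (cubicVec 0), M (cubicVec 3), M (quarticVec 0), M (quarticVec 1), M (quarticVec 2),
    M (quarticVec 3)]

include hker in
theorem map_coordinate_vectors :
    (∀ i, M (cubicVec i) = ![specialVec M 0, -specialVec M 2, -specialVec M 5, specialVec M 1] i) ∧
    (∀ j, M (quarticVec j) =
      ![specialVec M 2, specialVec M 3, specialVec M 4, specialVec M 5, -specialVec M 2] j) := by
  have h : ∀ i, M (specialCenter i) = 0 := apply_eq_zero_of_center hker
  have h0 : M (cubicVec 1) + M (quarticVec 0) = 0 := by simpa [specialCenter] using h 0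
  have h1 : M (quarticVec 0) + M (quarticVec 4) = 0 := by simpa [specialCenter] using h 1
  have h2 : M (cubicVec 2) + M (quarticVec 3) = 0 := by simpa [specialCenter] using h 2
  constructor
  · intro i
    fin_cases i
    · rfl
    · exact eq_neg_of_add_eq_zero_left h0
    · exact eq_neg_of_add_eq_zero_left h2
    · rfl
  · intro j
    fin_cases j
    · rfl
    · rfl
    · rfl
    · rfl
    · exact eq_neg_of_add_eq_zero_right h1

include hM hker in
theorem exists_basis_specialVec :
    ∃ b : Module.Basis (Fin 6) ℂ (Fin 6 → ℂ), ⇑b = specialVec M := by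
  have htop : ⊤ ≤ Submodule.span ℂ (Set.range (specialVec M)) := by
    have hE : ∀ i, specialVec M i ∈ Submodule.span ℂ (Set.range (specialVec M)) :=
      fun i => Submodule.subset_span ⟨i, rfl⟩
    have hE' : ∀ i, -specialVec M i ∈ Submodule.span ℂ (Set.range (specialVec M)) :=
      fun i => Submodule.neg_mem _ (hE i)
    obtain ⟨hX, hY⟩ := map_coordinate_vectors hker
    intro y _
    obtain ⟨x, rfl⟩ := hM y
    rw [← Finset.univ_sum_single x, map_sum]
    refine Submodule.sum_mem _ fun m _ => ?_
    have hm : (Pi.single m (x m) : C9) = x m • Pi.single m 1 := by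
      rw [← Pi.single_smul, smul_eq_mul, mul_one]
    rw [hm, map_smul]
    refine Submodule.smul_mem _ _ ?_
    rcases m with i | j
    · change M (cubicVec i) ∈ _
      rw [hX]
      fin_cases i
      exacts [hE 0, hE' 2, hE' 5, hE 1]
    · change M (quarticVec j) ∈ _
      rw [hY]
      fin_cases j
      exacts [hE 2, hE 3, hE 4, hE 5, hE' 2]
  exact ⟨basisOfTopLeSpanOfCardEqFinrank _ htop (by simp),
    coe_basisOfTopLeSpanOfCardEqFinrank _ htop (by simp)⟩

set_option linter.unusedSimpArgs false in
include hM hker in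
-- In the basis `specialVec` the eight apolarity equations leave seven of the fifteen entries of an
-- alternating form free; the Plücker relations on these are solved by
-- `eq_zero_of_specialPlane_equations`.
theorem hasAvoidingHyperplane_specialCenter : HasAvoidingHyperplane (projCoeffs M) := by
  obtain ⟨e, he⟩ := exists_basis_specialVec hM hker
  obtain ⟨hX, hY⟩ := map_coordinate_vectors hker
  -- The hyperplane is w(e₀,e₁) + w(e₃,e₄) + w(e₂,e₅) + w(e₀,e₅) = 0, that is A + B + u + v = 0.
  refine ⟨fun q => e 0 q.1 * e 1 q.2 + e 3 q.1 * e 4 q.2 + e 2 q.1 * e 5 q.2 + e 0 q.1 * e 5 q.2,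
    fun w hw hc hH => ?_⟩
  have hd : ∀ i, bil w (e i) (e i) = 0 := fun i => bil_self hw.diag hw.swap _
  have hsw : ∀ i j, bil w (e i) (e j) = -bil w (e j) (e i) :=
    fun i j => bil_swap hw.diag hw.swap _ _
  have hp := fun i j k l => hw.bil_plucker (e i) (e j) (e k) (e l)
  have hH' : bil w (e 0) (e 1) + bil w (e 3) (e 4) + bil w (e 2) (e 5) + bil w (e 0) (e 5) = 0 := by
    rw [← hH]
    simp only [bil_apply, Fintype.sum_prod_type, ← Finset.sum_add_distrib]
    exact Finset.sum_congr rfl fun i _ => Finset.sum_congr rfl fun j _ => by ring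
  obtain ⟨a0, a1, a2, a3, a4, a5, a6, a7⟩ := forall_antidiagSum_eq fun i j =>
    bil w (M (cubicVec i)) (M (quarticVec j))
  simp only [contract_coeffCol_projCoeffs hw.diag hw.swap] at hc
  replace a0 := a0.symm.trans (hc 0)
  replace a1 := a1.symm.trans (hc 1)
  replace a2 := a2.symm.trans (hc 2)
  replace a3 := a3.symm.trans (hc 3)
  replace a4 := a4.symm.trans (hc 4)
  replace a5 := a5.symm.trans (hc 5)
  replace a6 := a6.symm.trans (hc 6)
  replace a7 := a7.symm.trans (hc 7)
  simp only [hX, hY, ← he] at a0 a1 a2 a3 a4 a5 a6 a7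
  simp [hd] at a0 a1 a2 a3 a4 a5 a6 a7
  generalize hb : (fun i j => bil w (e i) (e j)) = b at *
  replace hb : ∀ i j, bil w (e i) (e j) = b i j := fun i j => congrFun (congrFun hb i) j
  simp only [hb] at hd hsw hp hH' a0 a1 a2 a3 a4 a5 a6 a7
  have e15 : b 1 5 = b 2 5 := by linear_combination a6 - hsw 5 2
  have e23 : b 2 3 = b 0 4 + b 2 5 := by linear_combination -a2 - hsw 5 2
  have e24 : b 2 4 = b 0 5 + b 3 5 := by linear_combination -a3 - hsw 5 3 + a7
  have e13 : b 1 3 = b 2 5 - b 4 5 := by linear_combination a4 + a0 + hsw 5 4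
  obtain ⟨z01, z34, z04, z25, z05, z35, z45⟩ := eq_zero_of_specialPlane_equations
    (A := b 0 1) (B := b 3 4) (s := b 0 4) (u := b 2 5) (v := b 0 5) (w := b 3 5) (x := b 4 5)
    (by have h := hp 0 1 2 3; simp only [a0, a1, a5, a7, e15, e23, e24, e13] at h; linear_combination h)
    (by have h := hp 0 1 2 5; simp only [a0, a1, a5, a7, e15, e23, e24, e13] at h; linear_combination h)
    (by have h := hp 0 1 3 4; simp only [a0, a1, a5, a7, e15, e23, e24, e13] at h; linear_combination h)
    (by have h := hp 0 1 4 5; simp only [a0, a1, a5, a7, e15, e23, e24, e13] at h; linear_combination h)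
    (by have h := hp 0 2 3 4; simp only [a0, a1, a5, a7, e15, e23, e24, e13] at h; linear_combination h)
    (by have h := hp 0 2 3 5; simp only [a0, a1, a5, a7, e15, e23, e24, e13] at h; linear_combination h)
    (by have h := hp 0 3 4 5; simp only [a0, a1, a5, a7, e15, e23, e24, e13] at h; linear_combination h)
    (by have h := hp 1 2 3 4; simp only [a0, a1, a5, a7, e15, e23, e24, e13] at h; linear_combination -h)
    (by have h := hp 1 2 3 5; simp only [a0, a1, a5, a7, e15, e23, e24, e13] at h; linear_combination h)
    (by have h := hp 1 2 4 5; simp only [a0, a1, a5, a7, e15, e23, e24, e13] at h; linear_combination h)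
    (by have h := hp 1 3 4 5; simp only [a0, a1, a5, a7, e15, e23, e24, e13] at h; linear_combination h)
    (by have h := hp 2 3 4 5; simp only [a0, a1, a5, a7, e15, e23, e24, e13] at h; linear_combination h)
    (by have h := hp 0 1 2 4; simp only [a0, a1, a5, a7, e15, e23, e24, e13] at h; linear_combination h)
    (by have h := hp 0 1 3 5; simp only [a0, a1, a5, a7, e15, e23, e24, e13] at h; linear_combination h)
    hH'
  have hup : ∀ i j, i < j → b i j = 0 := by
    intro i j hij
    fin_cases i <;> fin_cases j <;> first | exact absurd hij (by decide) | skip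
    all_goals simp [a0, a1, a5, a7, e15, e23, e24, e13, z01, z34, z04, z25, z05, z35, z45]
  have hb0 : ∀ i j, b i j = 0 := by
    intro i j
    rcases lt_trichotomy i j with h | rfl | h
    · exact hup i j h
    · exact hd i
    · rw [hsw, hup j i h, neg_zero]
  have hw0 : bil w = 0 := e.ext fun i => e.ext fun j => by rw [hb, hb0]; rfl
  funext q
  rw [← bil_single w q.1 q.2, hw0]
  rfl

include hM hker in
-- Contracting a linear relation with exterior products of dual basis vectors reads off its
-- coefficients. The entries 02 and 12 give x 0 - x 4 and x 3 - x 7; the others used give single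
-- coefficients.
theorem injective_coeffMap_specialCenter : Function.Injective (coeffMap (projCoeffs M)) := by
  obtain ⟨e, he⟩ := exists_basis_specialVec hM hker
  obtain ⟨hX, hY⟩ := map_coordinate_vectors hker
  rw [← LinearMap.ker_eq_bot, LinearMap.ker_eq_bot']
  intro x hx
  have hcomp : ∀ i j, e.coord i (e j) = if j = i then 1 else 0 := fun i j => by
    rw [Module.Basis.coord_apply, e.repr_self, Finsupp.single_apply]
  let β : Fin 6 → Fin 6 → Fin 4 → Fin 5 → ℂ := fun a b i j =>
    bil (wedgeForms (e.coord a) (e.coord b)) (M (cubicVec i)) (M (quarticVec j))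
  have key : ∀ a b, x 0 * β a b 0 0 + x 1 * (β a b 0 1 + β a b 1 0) +
      x 2 * (β a b 0 2 + (β a b 1 1 + β a b 2 0)) +
      x 3 * (β a b 0 3 + (β a b 1 2 + (β a b 2 1 + β a b 3 0))) +
      x 4 * (β a b 0 4 + (β a b 1 3 + (β a b 2 2 + β a b 3 1))) +
      x 5 * (β a b 1 4 + (β a b 2 3 + β a b 3 2)) +
      x 6 * (β a b 2 4 + β a b 3 3) + x 7 * β a b 3 4 = 0 := by
    intro a b
    have hw := isDecomposable_wedgeForms (e.coord a) (e.coord b)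
    have h := congrArg (contract (wedgeForms (e.coord a) (e.coord b))) hx
    simp only [coeffMap_apply, map_sum, map_smul, map_zero, smul_eq_mul,
      contract_coeffCol_projCoeffs hw.diag hw.swap] at h
    obtain ⟨a0, a1, a2, a3, a4, a5, a6, a7⟩ := forall_antidiagSum_eq (β a b)
    rwa [Fin.sum_univ_eight, a0, a1, a2, a3, a4, a5, a6, a7] at h
  simp only [β, hX, hY, ← he, bil_wedgeForms] at key
  have h02 := key 0 2
  have h03 := key 0 3
  have h04 := key 0 4
  have h05 := key 0 5
  have h13 := key 1 3
  have h14 := key 1 4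
  have h15 := key 1 5
  have h12 := key 1 2
  simp [hcomp] at h02 h03 h04 h05 h13 h14 h15 h12
  funext i
  fin_cases i
  · simpa [h13] using h02
  · exact h03
  · exact h04
  · exact h05
  · exact h13
  · exact h14
  · simpa using h15
  · simpa [h05] using h12

end SpecialCenter

/-! ### General members of the family -/

theorem IsPolyFun.prod {τ ι : Type*} (s : Finset ι) {g : ι → (τ → ℂ) → ℂ}
    (hg : ∀ i, IsPolyFun (g i)) : IsPolyFun fun x => ∏ i ∈ s, g i x := by
  choose P hP using hg
  exact ⟨∏ i ∈ s, P i, fun x => by simp only [map_prod, hP]⟩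

/-- The parameters of the `i`-th of three secant points. -/
def secantParams (q : Fin 3 × (Fin 4 × Fin 2) → ℂ) (i : Fin 3) (m : Fin 4 × Fin 2) : ℂ := q (i, m)

theorem exists_secantParams_eq (q q' q'' : Fin 4 × Fin 2 → ℂ) :
    ∃ p, secantParams p 0 = q ∧ secantParams p 1 = q' ∧ secantParams p 2 = q'' :=
  ⟨fun m => ![q, q', q''] m.1 m.2, rfl, rfl, rfl⟩

/-- The product of the brackets and coefficients that must not vanish in order that the three
secant points have the position required in `mk_projCoeffs_mem_familyU`. -/
def positionProd (q : Fin 3 × (Fin 4 × Fin 2) → ℂ) : ℂ :=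
  (∏ i, ∏ j, bracket (fun m => q (i, (0, m))) (fun m => q (j, (1, m)))) *
    (∏ i, ∏ j, if i = j then 1 else bracket (fun m => q (i, (0, m))) (fun m => q (j, (0, m)))) *
    ((∏ i, q (i, (2, 0))) * ∏ i, q (i, (3, 0)))

theorem isPolyFun_positionProd : IsPolyFun positionProd := by
  have hb : ∀ i j a b, IsPolyFun fun q : Fin 3 × (Fin 4 × Fin 2) → ℂ =>
      bracket (fun m => q (i, (a, m))) (fun m => q (j, (b, m))) := fun i j a b =>
    ((IsPolyFun.coord _).mul (IsPolyFun.coord _)).sub ((IsPolyFun.coord _).mul (IsPolyFun.coord _))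
  refine ((IsPolyFun.prod _ fun i => IsPolyFun.prod _ fun j => hb i j 0 1).mul
    (IsPolyFun.prod _ fun i => IsPolyFun.prod _ fun j => ?_)).mul
    ((IsPolyFun.prod _ fun i => IsPolyFun.coord _).mul (IsPolyFun.prod _ fun i => IsPolyFun.coord _))
  by_cases h : i = j
  · simpa only [h, if_true] using IsPolyFun.const 1
  · simpa only [h, if_false] using hb i j 0 0

theorem exists_positionProd_ne_zero : ∃ q, positionProd q ≠ 0 := by
  -- The six points (1, 0), …, (1, 5) of ℙ¹ are distinct; all secant coefficients are 1.
  refine ⟨fun x => ![![1, (x.1 : ℂ)] x.2.2, ![1, (x.1 : ℂ) + 3] x.2.2, 1, 1] x.2.1, ?_⟩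
  simp [positionProd, bracket, Fin.prod_univ_three]
  norm_num

/-! ### Irreducibility of the parameter space and density. -/

section Core

variable {S : Set (MvPolynomial (PIdx × Fin 8) ℂ)} (hS : ∀ F ∈ S, ∃ n, F.IsHomogeneous n)
  (hgen : ∀ c, (∃ F ∈ S, MvPolynomial.eval c F ≠ 0) ↔
    Function.Injective (coeffMap c) ∧ HasAvoidingHyperplane c)
  {M₀ : C9 →ₗ[ℂ] (Fin 6 → ℂ)} (hM₀ : Function.Surjective M₀) {a₀ : Fin 3 → C9}
  (hker : LinearMap.ker M₀ = Submodule.span ℂ (Set.range a₀))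

theorem eval_rep_mk_ne_zero {c : Coeffs} (hc : c ≠ 0) {F : MvPolynomial (PIdx × Fin 8) ℂ} {d : ℕ}
    (hF : F.IsHomogeneous d) (h : MvPolynomial.eval c F ≠ 0) :
    MvPolynomial.eval (Projectivization.mk ℂ c hc).rep F ≠ 0 := by
  obtain ⟨r, hr, hrep⟩ := rep_mk_eq_smul hc
  rw [hrep, IsHomFun.eval_smul (g := fun c => MvPolynomial.eval c F) ⟨F, hF, fun _ => rfl⟩]
  exact mul_ne_zero (pow_ne_zero _ hr) h

include hS hgen hM₀ hker in
/-- If a form in the coefficients does not vanish at some projection from a plane 3-secant to the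
secant variety, then it does not vanish at some generic member of the family. -/
theorem exists_mem_familyU_eval_ne_zero (ha₀ : LinearIndependent ℂ a₀)
    (hsec : ∀ i, InSecantCone (a₀ i)) {F : MvPolynomial (PIdx × Fin 8) ℂ} {d : ℕ}
    (hF : F.IsHomogeneous d) (h : MvPolynomial.eval (projCoeffs M₀) F ≠ 0) :
    ∃ f ∈ familyU, (∃ G ∈ S, MvPolynomial.eval f.rep G ≠ 0) ∧ MvPolynomial.eval f.rep F ≠ 0 := by
  -- One complement serves both the given center and the special one, so a single polynomial family
  -- of projections contains multiples of both.
  obtain ⟨l, h₀, hl⟩ := exists_tripleDet_ne_zero ha₀ linearIndependent_specialCenter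
  have hN := surjective_comp_projAlong hM₀ hker h₀ hl
  have hNker := ker_comp_projAlong hker h₀ hl
  obtain ⟨Q, hQS, hQ⟩ := (hgen _).2
    ⟨injective_coeffMap_specialCenter hN hNker, hasAvoidingHyperplane_specialCenter hN hNker⟩
  obtain ⟨n, hQn⟩ := hS Q hQS
  have hsecPoly : ∀ i m, IsPolyFun fun q => secantPt (secantParams q i) m := fun i m =>
    (isPolyFun_secantPt m).comp fun _ => IsPolyFun.coord _
  -- A function that is nonzero somewhere on the secant cone is nonzero at some parametrized triple
  -- of secant points.
  have transfer : ∀ {R : C9 → C9 → C9 → ℂ} {d : ℕ} {a : Fin 3 → C9},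
      (∀ b c, IsHomFun d fun a => R a b c) → (∀ a c, IsHomFun d fun b => R a b c) →
      (∀ a b, IsHomFun d fun c => R a b c) → (∀ i, InSecantCone (a i)) → R (a 0) (a 1) (a 2) ≠ 0 →
      ∃ q, R (secantPt (secantParams q 0)) (secantPt (secantParams q 1))
        (secantPt (secantParams q 2)) ≠ 0 := by
    intro R d a h₁ h₂ h₃ ha hR
    by_contra! hc
    refine hR (eq_zero_of_inSecantCone h₁ h₂ h₃ (fun q q' q'' => ?_) (ha 0) (ha 1) (ha 2))
    obtain ⟨p, rfl, rfl, rfl⟩ := exists_secantParams_eq q q' q''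
    exact hc p
  have hFc : evalCenter l M₀ F (a₀ 0) (a₀ 1) (a₀ 2) ≠ 0 := by
    rw [evalCenter, comp_projAlong_self hker, projCoeffs_smul,
      IsHomFun.eval_smul (g := fun c => MvPolynomial.eval c F) ⟨F, hF, fun _ => rfl⟩]
    exact mul_ne_zero (pow_ne_zero _ (mul_ne_zero h₀ h₀)) h
  have e₁ := transfer (isHomFun_evalCenter_left l M₀ hF) (isHomFun_evalCenter_middle l M₀ hF)
    (isHomFun_evalCenter_right l M₀ hF) hsec hFc
  have e₂ := transfer (isHomFun_evalCenter_left l M₀ hQn) (isHomFun_evalCenter_middle l M₀ hQn)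
    (isHomFun_evalCenter_right l M₀ hQn) inSecantCone_specialCenter hQ
  have e₃ := transfer (isHomFun_tripleDet_left l) (isHomFun_tripleDet_middle l)
    (isHomFun_tripleDet_right l) hsec h₀
  have p₁ := isPolyFun_evalCenter l M₀ (F := F) (hsecPoly 0) (hsecPoly 1) (hsecPoly 2)
  have p₂ := isPolyFun_evalCenter l M₀ (F := Q) (hsecPoly 0) (hsecPoly 1) (hsecPoly 2)
  have p₃ := isPolyFun_tripleDet l (hsecPoly 0) (hsecPoly 1) (hsecPoly 2)
  -- The four conditions are nonzero polynomials on one affine space, so they hold simultaneously at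
  -- some q: F is nonzero, the member is generic, the center is transverse to the complement, and
  -- the secants are in general position.
  obtain ⟨q, hq⟩ := IsPolyFun.exists_mul_ne_zero (p₁.mul p₂) (p₃.mul isPolyFun_positionProd)
    (IsPolyFun.exists_mul_ne_zero p₁ p₂ e₁ e₂)
    (IsPolyFun.exists_mul_ne_zero p₃ isPolyFun_positionProd e₃ exists_positionProd_ne_zero)
  have hqF := left_ne_zero_of_mul (left_ne_zero_of_mul hq)
  have hqQ := right_ne_zero_of_mul (left_ne_zero_of_mul hq)
  have hqt := left_ne_zero_of_mul (right_ne_zero_of_mul hq)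
  have hqp := right_ne_zero_of_mul (right_ne_zero_of_mul hq)
  let a : Fin 3 → C9 := fun i => secantPt (secantParams q i)
  replace hqt : tripleDet l (a 0) (a 1) (a 2) ≠ 0 := hqt
  let N := M₀ ∘ₗ projAlong l (a 0) (a 1) (a 2)
  have hinj := ((hgen (projCoeffs N)).1 ⟨Q, hQS, hqQ⟩).1
  have hN0 : projCoeffs N ≠ 0 := by
    intro h0
    have h1 : (Pi.single 0 1 : Fin 8 → ℂ) = 0 := hinj (by
      simp only [coeffMap_apply, h0, map_zero]
      exact Finset.sum_eq_zero fun k _ => smul_zero _)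
    simpa using congrFun h1 0
  simp only [positionProd, mul_ne_zero_iff, Finset.prod_ne_zero_iff, Finset.mem_univ,
    true_implies] at hqp
  refine ⟨Projectivization.mk ℂ (projCoeffs N) hN0, ?_, ⟨Q, hQS, eval_rep_mk_ne_zero hN0 hQn hqQ⟩,
    eval_rep_mk_ne_zero hN0 hF hqF⟩
  exact mk_projCoeffs_mem_familyU (surjective_comp_projAlong hM₀ hker h₀ hqt)
    (s := fun i m => q (i, (0, m))) (t := fun i m => q (i, (1, m)))
    (α := fun i => q (i, (2, 0))) (β := fun i => q (i, (2, 1)))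
    (γ := fun i => q (i, (3, 0))) (δ := fun i => q (i, (3, 1)))
    (linearIndependent_of_tripleDet_ne_zero hqt) (ker_comp_projAlong hker h₀ hqt)
    hqp.1.1 (fun i j hij => by simpa only [hij, if_false] using hqp.1.2 i j) hqp.2.1 hqp.2.2
    hinj hN0

end Core

/-- Only the projection data of a member are kept; the bisecant and embedding conditions play no
role in density. -/
theorem exists_center_of_mem_familyU {f : ℙ ℂ Coeffs} (hf : f ∈ familyU) :
    ∃ (a : Fin 3 → C9) (M : C9 →ₗ[ℂ] (Fin 6 → ℂ)) (r : ℂ), LinearIndependent ℂ a ∧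
      (∀ i, InSecantCone (a i)) ∧ Function.Surjective M ∧
      LinearMap.ker M = Submodule.span ℂ (Set.range a) ∧ f.rep = r • projCoeffs M := by
  obtain ⟨hf7, -, -, a, M, ha, hrank, hM, hker, -, hval⟩ := hf
  obtain ⟨r, hr⟩ := exists_eq_smul_projCoeffs hf7 hval
  have hspan : (⨆ i, (a i).submodule : Submodule ℂ C9) =
      Submodule.span ℂ (Set.range fun i => (a i).rep) := by
    rw [Submodule.span_range_eq_iSup]
    simp only [Projectivization.submodule_eq]
  refine ⟨fun i => (a i).rep, M, r, ?_, fun i => inSecantCone_rep (ha i), hM, hker.trans hspan, hr⟩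
  rw [linearIndependent_iff_card_eq_finrank_span, Set.finrank, ← hspan, hrank, Fintype.card_fin]

theorem forGeneral_familyU : ForGeneral familyU fun f =>
    (W1 (imageCurve f)).Finite ∧ Module.finrank ℂ (linSpan (imageCurve f)) = 7 + 1 ∧
      IsRationalNormalCurve 7 (imageCurve f) := by
  obtain ⟨S, hS, hgen⟩ := exists_polynomials_iff_generic
  refine ⟨{x | ∀ G ∈ S, MvPolynomial.eval x.rep G = 0}, ⟨S, hS, rfl⟩, ?_, ?_, ?_⟩
  · obtain ⟨M, hM, hker⟩ := exists_surjective_ker_eq_span linearIndependent_specialCenter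
    -- Nonemptiness is the density statement for the constant form 1.
    obtain ⟨f, hf, ⟨G, hG, hGf⟩, -⟩ := exists_mem_familyU_eval_ne_zero hS hgen hM hker
      linearIndependent_specialCenter inSecantCone_specialCenter
      (MvPolynomial.isHomogeneous_one (PIdx × Fin 8) ℂ) (by simp)
    exact ⟨f, hf, fun h => hGf (h G hG)⟩
  · rintro f hf _ ⟨T, hT, rfl⟩ hsub F hF
    obtain ⟨d, hd⟩ := hT F hF
    obtain ⟨a, M, r, ha, hsec, hM, hker, hr⟩ := exists_center_of_mem_familyU hf
    -- A form vanishing on all generic members vanishes at f: otherwise it would be nonzero at some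
    -- generic member.
    have h0 : MvPolynomial.eval (projCoeffs M) F = 0 := by
      by_contra hne
      obtain ⟨g, hg, ⟨G, hG, hGg⟩, hFg⟩ :=
        exists_mem_familyU_eval_ne_zero hS hgen hM hker ha hsec hd hne
      exact hFg (hsub ⟨hg, fun h => hGg (h G hG)⟩ F hF)
    rw [hr, IsHomFun.eval_smul (g := fun c => MvPolynomial.eval c F) ⟨F, hd, fun _ => rfl⟩, h0,
      mul_zero]
  · rintro f ⟨-, hf⟩
    have hex : ∃ G ∈ S, MvPolynomial.eval f.rep G ≠ 0 := by
      simpa only [Set.mem_ofPred_eq, not_forall, exists_prop] using hf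
    obtain ⟨hinj, hav⟩ := (hgen _).1 hex
    exact ⟨finite_W1 hav, finrank_linSpan_imageCurve hinj, isRationalNormalCurve_imageCurve hinj⟩

end SepticScroll

end

theorem mainTheorem8 :
    SepticScroll.ForGeneral SepticScroll.familyU (fun f =>
      (SepticScroll.W1 (SepticScroll.imageCurve f)).Finite ∧
      Module.finrank ℂ (SepticScroll.linSpan (SepticScroll.imageCurve f)) = 7 + 1 ∧
      SepticScroll.IsRationalNormalCurve 7 (SepticScroll.imageCurve f)) := by
  exact SepticScroll.forGeneral_familyU
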